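/- Infons are generated by $\varphi ::= \top \mid \bot \mid a \mid (\varphi\wedge\varphi)\mid(\varphi\to\varphi)$, where $a$ ranges over a set of atomic infons named by the words in $\{0,1\}^*$. The derivability relation $\Gamma\vdash\varphi$ of primal infon logic $\mathbf P$ ($\Gamma$ a set of infons) is given by $\vdash\top$, $\varphi\vdash\varphi$, weakening, cut, the usual introduction and elimination rules for $\wedge$, the rule "from $\Gamma\vdash\psi$ infer $\Gamma\vdash\varphi\to\psi$" and the rule "from $\Gamma\vdash\varphi$ and $\Gamma\vdash\varphi\to\psi$ infer $\Gamma\vdash\psi$"; in $\mathbf P$ the constant $\bot$ is an ordinary atom. The logic $\mathbf P[\bot_w]$ ($\bot$ as a universal key) has in addition the rule "from $\Gamma\vdash\bot$ and $\Gamma\vdash\varphi\to\psi$ infer $\Gamma\vdash\psi$". The positive atoms are defined by $At^+(q)=\{q\}$ for $q$ atomic or $q\in\{\top,\bot\}$, $At^+(\varphi\wedge\psi)=At^+(\varphi)\cup At^+(\psi)$, $At^+(\varphi\to\psi)=At^+(\psi)$, and $At^+(\Gamma)=\bigcup_{\gamma\in\Gamma}At^+(\gamma)$. Theorem. 1. The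 derivability problem for $\mathbf P[\bot_w]$ is decidable in linear time: there are a random access machine (unit-cost instructions: constants, addition, truncated subtraction, indirect load and store, reading an input symbol at a given position, jump, jump on zero) and constants $C,k$ such that on every string $w$ over the input alphabet $\{\top,\bot,x,0,1,(,),\wedge,\to,\text{','},\vdash\}$ the machine halts after at most $C(|w|+1)$ steps, holds only numbers that are at most $C(|w|+1)^k$ (that is, of $O(\log|w|)$ bits), and accepts if and only if $w$ is the string $\gamma_1,\gamma_2,\dots,\gamma_m,\vdash\varphi$ (with a comma after every hypothesis) of a sequent with $\{\gamma_1,\dots,\gamma_m\}\vdash\varphi$ in $\mathbf P[\bot_w]$. Here infons are written fully parenthesised, and the atom with name $b_1\dots b_r$ is written $x\,b_1\dots b_r$. 2. For every set $\Gamma$ of infons and every infon $\varphi$: $\Gamma\vdash\varphi$ in $\mathbf P[\bot_w]$ if and only if $\Gamma\vdash\varphi$ in $\mathbf P$, or $\Gamma\vdash\bot$ in $\mathbf P$ and $At^+(\varphi)\subseteq At^+(\Gamma)\cup\{\top\}$. -/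

import Mathlib

namespace PrimalInfon

/-! ## Infons and derivability -/

/-- Infons: built from the constants `⊤`, `⊥` and the atomic infons by conjunction and primal
implication. Atomic infons are named by binary words. -/
inductive Infon : Type
  | top : Infon
  | bot : Infon
  | atom (name : List Bool) : Infon
  | conj (φ ψ : Infon) : Infon
  | imp (φ ψ : Infon) : Infon
  deriving DecidableEq

/-- The two calculi: primal infon logic `P`, where `⊥` is an ordinary atom without rules, and
`P[⊥_w]`, where `⊥` is a universal key. -/
inductive InfonLogic : Type
  | P : InfonLogic
  | PBotW : InfonLogic

/-- The derivability relation `Γ ⊢ φ` of the two calculi. The contexts are sets of infons. -/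
inductive Derives (L : InfonLogic) : Set Infon → Infon → Prop
  | top : Derives L ∅ Infon.top
  | ax (φ : Infon) : Derives L {φ} φ
  | weakening (Γ Δ : Set Infon) (φ : Infon) : Derives L Γ φ → Derives L (Γ ∪ Δ) φ
  | cut (Γ : Set Infon) (φ ψ : Infon) :
      Derives L Γ φ → Derives L (Γ ∪ {φ}) ψ → Derives L Γ ψ
  | conjI (Γ : Set Infon) (φ ψ : Infon) :
      Derives L Γ φ → Derives L Γ ψ → Derives L Γ (Infon.conj φ ψ)
  | conjE₁ (Γ : Set Infon) (φ ψ : Infon) : Derives L Γ (Infon.conj φ ψ) → Derives L Γ φ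
  | conjE₂ (Γ : Set Infon) (φ ψ : Infon) : Derives L Γ (Infon.conj φ ψ) → Derives L Γ ψ
  | impI (Γ : Set Infon) (φ ψ : Infon) : Derives L Γ ψ → Derives L Γ (Infon.imp φ ψ)
  | impE (Γ : Set Infon) (φ ψ : Infon) :
      Derives L Γ φ → Derives L Γ (Infon.imp φ ψ) → Derives L Γ ψ
  | botE (Γ : Set Infon) (φ ψ : Infon) : L = InfonLogic.PBotW →
      Derives L Γ Infon.bot → Derives L Γ (Infon.imp φ ψ) → Derives L Γ ψ

/-- The positive atoms `At⁺(φ)` of an infon; `⊤` and `⊥` count as atoms here. -/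
def posAtoms : Infon → Set Infon
  | Infon.top => {Infon.top}
  | Infon.bot => {Infon.bot}
  | Infon.atom a => {Infon.atom a}
  | Infon.conj φ ψ => posAtoms φ ∪ posAtoms ψ
  | Infon.imp _ ψ => posAtoms ψ

/-- The positive atoms `At⁺(Γ)` of a context. -/
def posAtomsCtx (Γ : Set Infon) : Set Infon := ⋃ φ ∈ Γ, posAtoms φ

/-! ## Infons and sequents as strings over a finite alphabet -/

/-- The input alphabet `⊤ ⊥ x 0 1 ( ) ∧ → , ⊢`. -/
inductive Symbol : Type
  | top | bot | var | zero | one | lpar | rpar | and | imp | comma | turnstile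
  deriving DecidableEq

/-- The number by which a symbol is presented to a machine; `0` is kept for the blank. -/
def Symbol.code : Symbol → ℕ
  | .top => 1
  | .bot => 2
  | .var => 3
  | .zero => 4
  | .one => 5
  | .lpar => 6
  | .rpar => 7
  | .and => 8
  | .imp => 9
  | .comma => 10
  | .turnstile => 11

/-- The atom with name `b₁ … bₘ` is written `x b₁ … bₘ`; compound infons are written
`(φ∧ψ)` and `(φ→ψ)`. -/
def Infon.encode : Infon → List Symbol
  | .top => [.top]
  | .bot => [.bot]
  | .atom a => .var :: a.map (fun b => if b then .one else .zero)
  | .conj φ ψ => [.lpar] ++ φ.encode ++ [.and] ++ ψ.encode ++ [.rpar]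
  | .imp φ ψ => [.lpar] ++ φ.encode ++ [.imp] ++ ψ.encode ++ [.rpar]

/-- The sequent `γ₁, …, γₘ ⊢ φ` is written `γ₁,γ₂,…,γₘ,⊢φ` (a comma after every hypothesis). -/
def encodeSequent (Γ : List Infon) (φ : Infon) : List Symbol :=
  Γ.flatMap (fun γ => γ.encode ++ [.comma]) ++ [.turnstile] ++ φ.encode

/-- The derivability problem of a calculus: the set of all strings that represent a sequent
with a finite context that is derivable. -/
def derivabilityProblem (L : InfonLogic) : Language Symbol :=
  {w | ∃ (Γ : List Infon) (φ : Infon), w = encodeSequent Γ φ ∧ Derives L {γ | γ ∈ Γ} φ}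

/-! ## Random access machines -/

/-- Instructions of a random access machine. `d`, `a`, `b` are indices of registers. -/
inductive Instr : Type
  /-- `reg d := v` -/
  | const (d v : ℕ) : Instr
  /-- `reg d := reg a + reg b` -/
  | add (d a b : ℕ) : Instr
  /-- `reg d := reg a - reg b`, or `0` if this is negative -/
  | sub (d a b : ℕ) : Instr
  /-- `reg d := mem (reg a)` -/
  | load (d a : ℕ) : Instr
  /-- `mem (reg a) := reg b` -/
  | store (a b : ℕ) : Instr
  /-- `reg d :=` the input symbol at position `reg a`, counted from `0`; `0` past the end -/
  | input (d a : ℕ) : Instr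
  /-- go to instruction number `l` -/
  | jump (l : ℕ) : Instr
  /-- go to instruction number `l` if `reg a = 0`, and to the next instruction otherwise -/
  | jumpZero (a l : ℕ) : Instr

/-- A program is a finite list of instructions, numbered from `0`. -/
abbrev Program : Type := List Instr

/-- A configuration: program counter, registers, memory. -/
structure Config where
  pc : ℕ
  reg : ℕ → ℕ
  mem : ℕ → ℕ

/-- The initial configuration: everything is zero. -/
def Config.init : Config where
  pc := 0
  reg := fun _ => 0
  mem := fun _ => 0

/-- The effect of one instruction on a configuration, for the input `inp`. -/
def Instr.exec (inp : List ℕ) (c : Config) : Instr → Config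
  | .const d v => ⟨c.pc + 1, Function.update c.reg d v, c.mem⟩
  | .add d a b => ⟨c.pc + 1, Function.update c.reg d (c.reg a + c.reg b), c.mem⟩
  | .sub d a b => ⟨c.pc + 1, Function.update c.reg d (c.reg a - c.reg b), c.mem⟩
  | .load d a => ⟨c.pc + 1, Function.update c.reg d (c.mem (c.reg a)), c.mem⟩
  | .store a b => ⟨c.pc + 1, c.reg, Function.update c.mem (c.reg a) (c.reg b)⟩
  | .input d a => ⟨c.pc + 1, Function.update c.reg d (inp.getD (c.reg a) 0), c.mem⟩
  | .jump l => ⟨l, c.reg, c.mem⟩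
  | .jumpZero a l => ⟨if c.reg a = 0 then l else c.pc + 1, c.reg, c.mem⟩

/-- The machine halts when the program counter leaves the program. -/
def Halted (p : Program) (c : Config) : Prop := p.length ≤ c.pc

/-- One step of computation; halted configurations do not change. -/
def step (p : Program) (inp : List ℕ) (c : Config) : Config :=
  match p[c.pc]? with
  | some i => i.exec inp c
  | none => c

/-- The configuration after `t` steps on the input `inp`. -/
def run (p : Program) (inp : List ℕ) (t : ℕ) : Config := (step p inp)^[t] Config.init

/-- All registers and memory cells hold numbers that are at most `B`. -/
def Config.BoundedBy (c : Config) (B : ℕ) : Prop :=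
  (∀ i, c.reg i ≤ B) ∧ ∀ i, c.mem i ≤ B

/-- `L` is decidable in linear time: some random access machine halts on every string `w` after
at most `C * (|w| + 1)` steps, each of unit cost, with `reg 0 = 1` if and only if `w ∈ L`, and
all numbers that it ever holds (hence all addresses that it uses) are at most
`C * (|w| + 1) ^ k`, that is, they have `O(log |w|)` bits. -/
def DecidableInLinearTime (L : Language Symbol) : Prop :=
  ∃ (p : Program) (C k : ℕ), ∀ w : List Symbol,
    (∀ t, (run p (w.map Symbol.code) t).BoundedBy (C * (w.length + 1) ^ k)) ∧
    ∃ t ≤ C * (w.length + 1),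
      Halted p (run p (w.map Symbol.code) t) ∧
      ((run p (w.map Symbol.code) t).reg 0 = 1 ↔ w ∈ L)

end PrimalInfon

/-!
**Decidability.** Let `S` be the set of subformulas of a sequent `Γ ⊢ φ` together with `⊤` and `⊥`,
and let `D` be the least subset of `S` that contains `⊤` and `Γ` and is closed under the rules of
`P[⊥_w]` with all formulas in `S` (`LocallyClosed`). The valuation `Holds D` makes an implication
true if its conclusion is true or if it belongs to `D`; it agrees with `D` on `S` and respects all
rules, cut included. Hence `φ` is derivable if and only if `φ ∈ D`
(`LocallyClosed.mem_of_derives`).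

(The machine adds to `S` the atoms whose names are prefixes of names in `S`; this changes nothing.)

The set `D` is the least model of three Horn clauses for each compound member of `S`, all with at
most two premises, and such a model is found in linear time by forward chaining. To have equal
subformulas treated as one, the machine numbers the distinct infons while it parses the input. This
takes constant time per symbol, since a compound infon with parts number `l` and `r` is looked up in
a table of quadratic size whose cells are initially zero and are never cleared
(`Heap.eval_hashCons`); names of atoms are prolonged bit by bit in the same way. The parser is a
shift-reduce automaton, and it accepts exactly the sequents since its state determines the string
that it has read (`Parser.feed_eq_iff`).

The machine consists of three loops, which count, read (`Reading.step`), and chain forward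
(`ChainInv.step`). Their bodies are loop-free, so that their effect is a total function on states,
their running time is constant and they increase a bound of the numbers by a constant factor only
(`Code.reach_compile`). It remains to bound the number of iterations and the numbers at the head of
the loops. In forward chaining, each iteration takes an infon out of the queue or a clause out of
the list of an infon taken out, and both happen at most once (`potential`).

**The universal key.** By induction on derivations in `P[⊥_w]`, the conclusion or `⊥` is derivable
in `P`, and the positive atoms of the conclusion other than `⊤` are positive atoms of the context.
Conversely, `⊥` opens all implications, so all positive atoms of the context are derivable, and an
infon is derivable from its positive atoms (`derives_PBotW_iff`).
-/

namespace PrimalInfon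

/-! ### The calculi -/

theorem Derives.mono {L : InfonLogic} {Γ Δ : Set Infon} {φ : Infon} (h : Derives L Γ φ)
    (hΓ : Γ ⊆ Δ) : Derives L Δ φ := by
  simpa [Set.union_eq_self_of_subset_left hΓ] using Derives.weakening Γ Δ φ h

theorem Derives.of_mem {L : InfonLogic} {Γ : Set Infon} {φ : Infon} (h : φ ∈ Γ) :
    Derives L Γ φ :=
  (Derives.ax φ).mono (Set.singleton_subset_iff.2 h)

theorem Derives.top' {L : InfonLogic} (Γ : Set Infon) : Derives L Γ .top :=
  Derives.top.mono (Set.empty_subset Γ)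

theorem Derives.toPBotW {L : InfonLogic} {Γ : Set Infon} {φ : Infon} (h : Derives L Γ φ) :
    Derives .PBotW Γ φ := by
  induction h with
  | top => exact .top
  | ax φ => exact .ax φ
  | weakening Γ Δ φ _ ih => exact .weakening _ _ _ ih
  | cut Γ φ ψ _ _ ih₁ ih₂ => exact .cut _ _ _ ih₁ ih₂
  | conjI Γ φ ψ _ _ ih₁ ih₂ => exact .conjI _ _ _ ih₁ ih₂
  | conjE₁ Γ φ ψ _ ih => exact .conjE₁ _ _ _ ih
  | conjE₂ Γ φ ψ _ ih => exact .conjE₂ _ _ _ ih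
  | impI Γ φ ψ _ ih => exact .impI _ _ _ ih
  | impE Γ φ ψ _ _ ih₁ ih₂ => exact .impE _ _ _ ih₁ ih₂
  | botE Γ φ ψ _ _ _ ih₁ ih₂ => exact .botE _ _ _ rfl ih₁ ih₂

theorem mem_posAtomsCtx {Γ : Set Infon} {q : Infon} :
    q ∈ posAtomsCtx Γ ↔ ∃ γ ∈ Γ, q ∈ posAtoms γ := by
  simp [posAtomsCtx]

/-- No rule creates a positive atom other than `⊤`. -/
theorem Derives.posAtoms_subset {L : InfonLogic} {Γ : Set Infon} {φ : Infon}
    (h : Derives L Γ φ) : posAtoms φ ⊆ posAtomsCtx Γ ∪ {Infon.top} := by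
  induction h with
  | top => simp [posAtoms]
  | ax φ => exact fun q hq => Or.inl (mem_posAtomsCtx.2 ⟨φ, rfl, hq⟩)
  | weakening Γ Δ φ _ ih =>
    intro q hq
    rcases ih hq with h | h
    · obtain ⟨γ, hγ, h⟩ := mem_posAtomsCtx.1 h
      exact Or.inl (mem_posAtomsCtx.2 ⟨γ, Or.inl hγ, h⟩)
    · exact Or.inr h
  | cut Γ φ ψ _ _ ih₁ ih₂ =>
    intro q hq
    rcases ih₂ hq with h | h
    · obtain ⟨γ, hγ | rfl, hq⟩ := mem_posAtomsCtx.1 h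
      · exact Or.inl (mem_posAtomsCtx.2 ⟨γ, hγ, hq⟩)
      · exact ih₁ hq
    · exact Or.inr h
  | conjI Γ φ ψ _ _ ih₁ ih₂ => exact Set.union_subset ih₁ ih₂
  | conjE₁ Γ φ ψ _ ih => exact fun q hq => ih (Or.inl hq)
  | conjE₂ Γ φ ψ _ ih => exact fun q hq => ih (Or.inr hq)
  | impI Γ φ ψ _ ih => exact ih
  | impE Γ φ ψ _ _ _ ih => exact ih
  | botE Γ φ ψ _ _ _ _ ih => exact ih

/-- The universal key is of use only in contexts that yield `⊥` in the basic calculus. -/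
theorem Derives.toP_or_bot {L : InfonLogic} {Γ : Set Infon} {φ : Infon} (h : Derives L Γ φ) :
    Derives .P Γ φ ∨ Derives .P Γ .bot := by
  induction h with
  | top => exact .inl .top
  | ax φ => exact .inl (.ax φ)
  | weakening Γ Δ φ _ ih => exact ih.imp (.weakening _ _ _) (.weakening _ _ _)
  | cut Γ φ ψ _ _ ih₁ ih₂ =>
    rcases ih₁ with h₁ | h₁
    · exact ih₂.imp (.cut _ _ _ h₁) (.cut _ _ _ h₁)
    · exact .inr h₁
  | conjI Γ φ ψ _ _ ih₁ ih₂ =>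
    rcases ih₁ with h₁ | h₁
    · exact ih₂.imp_left (.conjI _ _ _ h₁)
    · exact .inr h₁
  | conjE₁ Γ φ ψ _ ih => exact ih.imp_left (.conjE₁ _ _ _)
  | conjE₂ Γ φ ψ _ ih => exact ih.imp_left (.conjE₂ _ _ _)
  | impI Γ φ ψ _ ih => exact ih.imp_left (.impI _ _ _)
  | impE Γ φ ψ _ _ ih₁ ih₂ =>
    rcases ih₁ with h₁ | h₁
    · exact ih₂.imp_left (.impE _ _ _ h₁)
    · exact .inr h₁
  | botE Γ φ ψ _ _ _ ih₁ _ => exact .inr (ih₁.elim id id)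

/-- With the key `⊥` at hand, every hypothesis can be taken apart into its positive atoms. -/
theorem Derives.posAtom {Γ : Set Infon} {γ q : Infon} (hbot : Derives .PBotW Γ .bot)
    (h : Derives .PBotW Γ γ) (hq : q ∈ posAtoms γ) : Derives .PBotW Γ q := by
  induction γ with
  | top => obtain rfl : q = .top := hq; exact h
  | bot => obtain rfl : q = .bot := hq; exact h
  | atom a => obtain rfl : q = .atom a := hq; exact h
  | conj φ ψ ih₁ ih₂ =>
    rcases hq with hq | hq
    · exact ih₁ (.conjE₁ _ _ _ h) hq
    · exact ih₂ (.conjE₂ _ _ _ h) hq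
  | imp φ ψ _ ih => exact ih (.botE _ _ _ rfl hbot h) hq

theorem Derives.of_posAtoms {L : InfonLogic} {Γ : Set Infon} {φ : Infon}
    (h : ∀ q ∈ posAtoms φ, Derives L Γ q) : Derives L Γ φ := by
  induction φ with
  | top => exact h _ rfl
  | bot => exact h _ rfl
  | atom a => exact h _ rfl
  | conj φ ψ ih₁ ih₂ =>
    exact .conjI _ _ _ (ih₁ fun q hq => h q (.inl hq)) (ih₂ fun q hq => h q (.inr hq))
  | imp φ ψ _ ih => exact .impI _ _ _ (ih h)

theorem derives_PBotW_iff (Γ : Set Infon) (φ : Infon) :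
    Derives .PBotW Γ φ ↔ Derives .P Γ φ ∨
      (Derives .P Γ .bot ∧ posAtoms φ ⊆ posAtomsCtx Γ ∪ {Infon.top}) := by
  constructor
  · exact fun h => h.toP_or_bot.imp_right fun hb => ⟨hb, h.posAtoms_subset⟩
  · rintro (h | ⟨hb, hsub⟩)
    · exact h.toPBotW
    · refine Derives.of_posAtoms fun q hq => ?_
      rcases hsub hq with h | rfl
      · obtain ⟨γ, hγ, h⟩ := mem_posAtomsCtx.1 h
        exact Derives.posAtom hb.toPBotW (Derives.of_mem hγ) h
      · exact Derives.top' Γ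

/-! ### Local derivations -/

/-- `D` is a part of the set `S` of infons, `S` contains the immediate subformulas of its members,
and `D` is closed under those instances of the rules of `P[⊥_w]` that stay inside `S`. -/
structure LocallyClosed (S D : Set Infon) : Prop where
  subset : D ⊆ S
  conj_sub : ∀ {φ ψ}, .conj φ ψ ∈ S → φ ∈ S ∧ ψ ∈ S
  imp_sub : ∀ {φ ψ}, .imp φ ψ ∈ S → φ ∈ S ∧ ψ ∈ S
  top_mem : Infon.top ∈ D
  conjI : ∀ {φ ψ}, .conj φ ψ ∈ S → φ ∈ D → ψ ∈ D → .conj φ ψ ∈ D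
  conjE : ∀ {φ ψ}, .conj φ ψ ∈ D → φ ∈ D ∧ ψ ∈ D
  impI : ∀ {φ ψ}, .imp φ ψ ∈ S → ψ ∈ D → .imp φ ψ ∈ D
  impE : ∀ {φ ψ}, .imp φ ψ ∈ D → φ ∈ D → ψ ∈ D
  botE : ∀ {φ ψ}, .imp φ ψ ∈ D → .bot ∈ D → ψ ∈ D

/-- The valuation that extends a locally closed set `D` to all infons: an implication holds if
its conclusion holds or if it belongs to `D`. -/
def Holds (D : Set Infon) : Infon → Prop
  | .top => True
  | .bot => .bot ∈ D
  | .atom a => .atom a ∈ D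
  | .conj φ ψ => Holds D φ ∧ Holds D ψ
  | .imp φ ψ => Holds D ψ ∨ .imp φ ψ ∈ D

theorem LocallyClosed.holds_iff {S D : Set Infon} (h : LocallyClosed S D) {φ : Infon}
    (hφ : φ ∈ S) : Holds D φ ↔ φ ∈ D := by
  induction φ with
  | top => simp [Holds, h.top_mem]
  | bot => rfl
  | atom a => rfl
  | conj φ ψ ih₁ ih₂ =>
    have hs := h.conj_sub hφ
    simp only [Holds, ih₁ hs.1, ih₂ hs.2]
    exact ⟨fun hd => h.conjI hφ hd.1 hd.2, h.conjE⟩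
  | imp φ ψ _ ih =>
    simp only [Holds, ih (h.imp_sub hφ).2]
    exact ⟨fun hd => hd.elim (h.impI hφ) id, .inr⟩

/-- The valuation respects every rule. Cut needs no elimination, as this is an argument about
truth. -/
theorem LocallyClosed.holds_of_derives {S D : Set Infon} (h : LocallyClosed S D)
    {L : InfonLogic} {Γ : Set Infon} {φ : Infon} (hd : Derives L Γ φ)
    (hΓ : ∀ γ ∈ Γ, Holds D γ) : Holds D φ := by
  induction hd with
  | top => trivial
  | ax φ => exact hΓ φ rfl
  | weakening Γ Δ φ _ ih => exact ih fun γ hγ => hΓ γ (.inl hγ)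
  | cut Γ φ ψ _ _ ih₁ ih₂ =>
    refine ih₂ ?_
    rintro γ (hγ | rfl)
    exacts [hΓ γ hγ, ih₁ hΓ]
  | conjI Γ φ ψ _ _ ih₁ ih₂ => exact ⟨ih₁ hΓ, ih₂ hΓ⟩
  | conjE₁ Γ φ ψ _ ih => exact (ih hΓ).1
  | conjE₂ Γ φ ψ _ ih => exact (ih hΓ).2
  | impI Γ φ ψ _ ih => exact .inl (ih hΓ)
  | impE Γ φ ψ _ _ ih₁ ih₂ =>
    rcases ih₂ hΓ with hψ | hi
    · exact hψ
    · have hs := h.imp_sub (h.subset hi)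
      exact (h.holds_iff hs.2).2 (h.impE hi ((h.holds_iff hs.1).1 (ih₁ hΓ)))
  | botE Γ φ ψ _ _ _ ih₁ ih₂ =>
    rcases ih₂ hΓ with hψ | hi
    · exact hψ
    · exact (h.holds_iff (h.imp_sub (h.subset hi)).2).2 (h.botE hi (ih₁ hΓ))

/-- The subformula property: rule instances inside `S` suffice for sequents inside `S`. -/
theorem LocallyClosed.mem_of_derives {S D : Set Infon} (h : LocallyClosed S D)
    {L : InfonLogic} {Γ : Set Infon} {φ : Infon} (hd : Derives L Γ φ) (hΓ : Γ ⊆ D)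
    (hφ : φ ∈ S) : φ ∈ D :=
  (h.holds_iff hφ).1
    (h.holds_of_derives hd fun _ hγ => (h.holds_iff (h.subset (hΓ hγ))).2 (hΓ hγ))

/-! ### A shift-reduce parser for sequents -/

/-- The two binary connectives. -/
inductive Conn : Type
  | and | imp

/-- The symbol of a connective. -/
def Conn.symbol : Conn → Symbol
  | .and => .and
  | .imp => .imp

/-- The compound infon with a given principal connective. -/
def Conn.mk : Conn → Infon → Infon → Infon
  | .and => .conj
  | .imp => .imp

theorem Conn.symbol_and : Conn.symbol .and = .and := rfl

theorem Conn.symbol_imp : Conn.symbol .imp = .imp := rfl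

theorem Conn.encode_mk (o : Conn) (φ ψ : Infon) :
    (o.mk φ ψ).encode = [.lpar] ++ φ.encode ++ [o.symbol] ++ ψ.encode ++ [.rpar] := by
  cases o <;> rfl

/-- An entry of the parsing stack: a parenthesis that waits for its left argument, or one with
its left argument and connective that waits for its right argument. -/
inductive Frame : Type
  | paren
  | left (o : Conn) (φ : Infon)

/-- What lies between the top of the stack and the read position: nothing, a complete infon, or
an atom whose name may go on. -/
inductive Focus : Type
  | start
  | done (φ : Infon)
  | word (a : List Bool)

/-- The infon in focus, if there is one. -/
def Focus.infon? : Focus → Option Infon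
  | .start => none
  | .done φ => some φ
  | .word a => some (.atom a)

/-- A state of the parser: the hypotheses read, whether `⊢` has been read, the open
parentheses (innermost first), and the focus. -/
structure Parser : Type where
  hyps : List Infon
  seen : Bool
  stack : List Frame
  focus : Focus

/-- The parser before the first symbol. -/
def Parser.init : Parser := ⟨[], false, [], .start⟩

/-- The effect of a connective. -/
def Parser.connective (σ : Parser) (o : Conn) : Option Parser :=
  match σ.focus.infon?, σ.stack with
  | some φ, .paren :: st => some { σ with stack := .left o φ :: st, focus := .start }
  | _, _ => none

/-- The effect of a bit. -/
def Parser.bit (σ : Parser) (b : Bool) : Option Parser :=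
  match σ.focus with
  | .word a => some { σ with focus := .word (a ++ [b]) }
  | _ => none

/-- The effect of a symbol with which an infon begins. -/
def Parser.start (σ : Parser) (f : Focus) : Option Parser :=
  match σ.focus with
  | .start => some { σ with focus := f }
  | _ => none

/-- The effect of one symbol on the parser; `none` stands for a syntax error. -/
def Parser.next (σ : Parser) : Symbol → Option Parser
  | .top => σ.start (.done .top)
  | .bot => σ.start (.done .bot)
  | .var => σ.start (.word [])
  | .zero => σ.bit false
  | .one => σ.bit true
  | .lpar =>
    match σ.focus with
    | .start => some { σ with stack := .paren :: σ.stack }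
    | _ => none
  | .rpar =>
    match σ.focus.infon?, σ.stack with
    | some ψ, .left o φ :: st => some { σ with stack := st, focus := .done (o.mk φ ψ) }
    | _, _ => none
  | .and => σ.connective .and
  | .imp => σ.connective .imp
  | .comma =>
    match σ.focus.infon?, σ.stack, σ.seen with
    | some φ, [], false => some { σ with hyps := σ.hyps ++ [φ], focus := .start }
    | _, _, _ => none
  | .turnstile =>
    match σ.focus, σ.stack, σ.seen with
    | .start, [], false => some { σ with seen := true }
    | _, _, _ => none

/-- The sequent that has been read, if the parser may stop here. -/
def Parser.result? (σ : Parser) : Option (List Infon × Infon) :=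
  match σ.focus.infon?, σ.stack, σ.seen with
  | some φ, [], true => some (σ.hyps, φ)
  | _, _, _ => none

/-- The effect of a string on the parser. -/
def Parser.feed (σ : Parser) (w : List Symbol) : Option Parser := w.foldlM Parser.next σ

@[simp] theorem Parser.feed_nil (σ : Parser) : σ.feed [] = some σ := rfl

theorem Parser.feed_cons (σ : Parser) (a : Symbol) (w : List Symbol) :
    σ.feed (a :: w) = (σ.next a).bind fun σ' => σ'.feed w := rfl

theorem Parser.feed_append (σ : Parser) (v w : List Symbol) :
    σ.feed (v ++ w) = (σ.feed v).bind fun σ' => σ'.feed w := by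
  simp [Parser.feed, List.foldlM_append]

/-- The string that a frame stands for. -/
def Frame.render : Frame → List Symbol
  | .paren => [.lpar]
  | .left o φ => [.lpar] ++ φ.encode ++ [o.symbol]

/-- The string that a stack stands for. -/
def renderStack : List Frame → List Symbol
  | [] => []
  | f :: st => renderStack st ++ f.render

/-- The string that the parser has read. -/
def Parser.render (σ : Parser) : List Symbol :=
  σ.hyps.flatMap (fun γ => γ.encode ++ [.comma]) ++ (if σ.seen then [.turnstile] else []) ++
    renderStack σ.stack ++ (σ.focus.infon?.map Infon.encode).getD []

/-- The state of the parser determines the string read; thus only sequents are accepted. -/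
theorem Parser.render_next {σ σ' : Parser} {a : Symbol} (h : σ.next a = some σ') :
    σ'.render = σ.render ++ [a] := by
  obtain ⟨hyps, seen, stack, focus⟩ := σ
  cases a <;>
    simp only [Parser.next, Parser.start, Parser.bit, Parser.connective] at h <;>
    split at h <;> simp only [Option.some.injEq, reduceCtorEq] at h <;> subst h <;>
    simp_all [Parser.render, Focus.infon?, Infon.encode, renderStack, Frame.render,
      Conn.encode_mk, Conn.symbol_and, Conn.symbol_imp]

theorem Parser.render_feed {σ σ' : Parser} {w : List Symbol} (h : σ.feed w = some σ') :
    σ'.render = σ.render ++ w := by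
  induction w generalizing σ with
  | nil => simp_all
  | cons a w ih =>
    rw [Parser.feed_cons, Option.bind_eq_some_iff] at h
    obtain ⟨τ, h₁, h₂⟩ := h
    simp [ih h₂, Parser.render_next h₁]

/-- Reading an infon leaves the stack and the hypotheses as they were. -/
theorem Parser.feed_encode (φ : Infon) (Γ : List Infon) (b : Bool) (st : List Frame) :
    ∃ f : Focus, f.infon? = some φ ∧
      Parser.feed ⟨Γ, b, st, .start⟩ φ.encode = some ⟨Γ, b, st, f⟩ := by
  induction φ generalizing st with
  | top => exact ⟨.done .top, rfl, rfl⟩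
  | bot => exact ⟨.done .bot, rfl, rfl⟩
  | atom a =>
    refine ⟨.word a, rfl, ?_⟩
    -- the word in focus is the part of the name that has been read
    have key : ∀ v u : List Bool, Parser.feed ⟨Γ, b, st, .word u⟩
        (v.map (fun b => if b then Symbol.one else .zero)) = some ⟨Γ, b, st, .word (u ++ v)⟩ := by
      intro v
      induction v with
      | nil => simp
      | cons c v ih =>
        intro u
        cases c <;> simp [Parser.feed_cons, Parser.next, Parser.bit, ih]
    simpa [Infon.encode, Parser.feed_cons, Parser.next, Parser.start] using key a []
  | conj φ ψ ih₁ ih₂ =>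
    obtain ⟨f, hf, h₁⟩ := ih₁ (.paren :: st)
    obtain ⟨g, hg, h₂⟩ := ih₂ (.left .and φ :: st)
    refine ⟨.done (.conj φ ψ), rfl, ?_⟩
    simp [Infon.encode, Parser.feed_cons, Parser.feed_append, Parser.next, h₁, h₂, hf, hg,
      Parser.connective, Conn.mk]
  | imp φ ψ ih₁ ih₂ =>
    obtain ⟨f, hf, h₁⟩ := ih₁ (.paren :: st)
    obtain ⟨g, hg, h₂⟩ := ih₂ (.left .imp φ :: st)
    refine ⟨.done (.imp φ ψ), rfl, ?_⟩
    simp [Infon.encode, Parser.feed_cons, Parser.feed_append, Parser.next, h₁, h₂, hf, hg,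
      Parser.connective, Conn.mk]

theorem Parser.feed_hyps (Γ Δ : List Infon) :
    Parser.feed ⟨Δ, false, [], .start⟩ (Γ.flatMap fun γ => γ.encode ++ [.comma]) =
      some ⟨Δ ++ Γ, false, [], .start⟩ := by
  induction Γ generalizing Δ with
  | nil => simp
  | cons γ Γ ih =>
    obtain ⟨f, hf, h⟩ := Parser.feed_encode γ Δ false []
    simp [Parser.feed_append, Parser.feed_cons, h, Parser.next, hf, ih]

/-- The parser accepts exactly the sequents. -/
theorem Parser.feed_eq_iff {w : List Symbol} {Γ : List Infon} {φ : Infon} :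
    (∃ σ, Parser.init.feed w = some σ ∧ σ.result? = some (Γ, φ)) ↔ w = encodeSequent Γ φ := by
  constructor
  · rintro ⟨⟨Δ, b, st, f⟩, h, hr⟩
    have hw := Parser.render_feed h
    simp only [Parser.result?] at hr
    split at hr <;> simp only [Option.some.injEq, reduceCtorEq, Prod.mk.injEq] at hr
    obtain ⟨rfl, rfl⟩ := hr
    simp_all [Parser.render, Parser.init, renderStack, Focus.infon?, encodeSequent]
  · rintro rfl
    obtain ⟨f, hf, h⟩ := Parser.feed_encode φ Γ true []
    refine ⟨⟨Γ, true, [], f⟩, ?_, by simp [Parser.result?, hf]⟩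
    simp [encodeSequent, Parser.feed_append, Parser.feed_cons, Parser.init, Parser.feed_hyps,
      Parser.next, h]

/-! ### A loop-free language and its compilation -/

/-- The variables of the loop-free language. The result of the computation is left in `out`, which
is register `0`. -/
inductive Var : Type
  | out | one | pos | sym | focus | cur | depth | top | seen | ok | run | cnt | ecnt | tail | head
  | size | row | lhs | rhs | tag | key | tmp | edge | item
  deriving DecidableEq

/-- The arrays of the loop-free language. -/
inductive Arr : Type
  | table | row | first | other | target | next | queue | mark | stackTag | stackArg
  deriving DecidableEq

/-- The register that holds a variable. -/
def Var.idx (v : Var) : ℕ := v.ctorIdx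

/-- The residue modulo 16 of the addresses that hold the cells of an array: cell `i` of the array
`f` has the address `16 * i + f.idx`. -/
def Arr.idx (f : Arr) : ℕ := f.ctorIdx

theorem Var.idx_injective : Function.Injective Var.idx := by
  intro a b h
  cases a <;> cases b <;> first | rfl | exact absurd h (by decide)

theorem Arr.idx_injective : Function.Injective Arr.idx := by
  intro a b h
  cases a <;> cases b <;> first | rfl | exact absurd h (by decide)

theorem Var.idx_lt (v : Var) : v.idx < 24 := by cases v <;> decide

theorem Arr.idx_lt (f : Arr) : f.idx < 16 := by cases f <;> decide

/-- A state of the loop-free language: the values of the variables and of the array cells. -/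
structure St : Type where
  reg : Var → ℕ
  fld : Arr → ℕ → ℕ

/-- The state in which everything is zero. -/
def St.init : St := ⟨fun _ => 0, fun _ _ => 0⟩

/-- Assignment to a variable. -/
def St.set (s : St) (d : Var) (v : ℕ) : St := ⟨fun e => if e = d then v else s.reg e, s.fld⟩

/-- Assignment to an array cell. -/
def St.put (s : St) (f : Arr) (i v : ℕ) : St :=
  ⟨s.reg, fun g j => if g = f ∧ j = i then v else s.fld g j⟩

@[simp] theorem St.reg_set (s : St) (d e : Var) (v : ℕ) :
    (s.set d v).reg e = if e = d then v else s.reg e := rfl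

@[simp] theorem St.fld_set (s : St) (d : Var) (v : ℕ) : (s.set d v).fld = s.fld := rfl

@[simp] theorem St.reg_put (s : St) (f : Arr) (i v : ℕ) : (s.put f i v).reg = s.reg := rfl

@[simp] theorem St.fld_put (s : St) (f g : Arr) (i j v : ℕ) :
    (s.put f i v).fld g j = if g = f ∧ j = i then v else s.fld g j := rfl

/-- All numbers in the state are at most `X`. -/
def St.Bdd (s : St) (X : ℕ) : Prop := (∀ v, s.reg v ≤ X) ∧ ∀ f i, s.fld f i ≤ X

theorem St.Bdd.set {s : St} {X v : ℕ} (h : s.Bdd X) (d : Var) (hv : v ≤ X) : (s.set d v).Bdd X := by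
  refine ⟨fun e => ?_, h.2⟩
  rw [St.reg_set]
  split
  exacts [hv, h.1 e]

theorem St.Bdd.put {s : St} {X v : ℕ} (h : s.Bdd X) (f : Arr) (i : ℕ) (hv : v ≤ X) :
    (s.put f i v).Bdd X := by
  refine ⟨h.1, fun g j => ?_⟩
  rw [St.fld_put]
  split
  exacts [hv, h.2 g j]

theorem St.Bdd.mono {s : St} {X Y : ℕ} (h : s.Bdd X) (hXY : X ≤ Y) : s.Bdd Y :=
  ⟨fun v => (h.1 v).trans hXY, fun f i => (h.2 f i).trans hXY⟩

/-- Loop-free programs. -/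
inductive Code : Type
  /-- do nothing -/
  | skip : Code
  /-- `d := v` -/
  | const (d : Var) (v : ℕ) : Code
  /-- `d := a` -/
  | mov (d a : Var) : Code
  /-- `d := a + b` -/
  | add (d a b : Var) : Code
  /-- `d := a - b`, truncated -/
  | sub (d a b : Var) : Code
  /-- `d :=` the input symbol at position `a` -/
  | input (d a : Var) : Code
  /-- `d := f[a]` -/
  | load (d : Var) (f : Arr) (a : Var) : Code
  /-- `f[a] := b` -/
  | store (f : Arr) (a b : Var) : Code
  /-- first `c₁`, then `c₂` -/
  | seq (c₁ c₂ : Code) : Code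
  /-- `c₁` if `a = 0`, and `c₂` otherwise -/
  | ifZero (a : Var) (c₁ c₂ : Code) : Code

infixr:65 " ;; " => Code.seq

/-- The effect of a loop-free program on a state. -/
def Code.eval (inp : List ℕ) : Code → St → St
  | .skip, s => s
  | .const d v, s => s.set d v
  | .mov d a, s => s.set d (s.reg a)
  | .add d a b, s => s.set d (s.reg a + s.reg b)
  | .sub d a b, s => s.set d (s.reg a - s.reg b)
  | .input d a, s => s.set d (inp.getD (s.reg a) 0)
  | .load d f a, s => s.set d (s.fld f (s.reg a))
  | .store f a b, s => s.put f (s.reg a) (s.reg b)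
  | .seq c₁ c₂, s => c₂.eval inp (c₁.eval inp s)
  | .ifZero a c₁ c₂, s => if s.reg a = 0 then c₁.eval inp s else c₂.eval inp s

/-- Instructions that put the address of the cell `f[a]` into register 24; register 25 is used
as well. Four doublings multiply by 16. -/
def addressCode (f : Arr) (a : Var) : List Instr :=
  [.add 24 a.idx a.idx, .add 24 24 24, .add 24 24 24, .add 24 24 24, .const 25 f.idx,
    .add 24 24 25]

/-- The number of instructions of the compiled program. -/
def Code.len : Code → ℕ
  | .skip => 0
  | .const _ _ => 1
  | .mov _ _ => 2
  | .add _ _ _ => 1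
  | .sub _ _ _ => 1
  | .input _ _ => 1
  | .load _ _ _ => 7
  | .store _ _ _ => 7
  | .seq c₁ c₂ => c₁.len + c₂.len
  | .ifZero _ c₁ c₂ => c₁.len + c₂.len + 2

/-- The instructions of a loop-free program that is placed at position `o`. -/
def Code.compile : Code → ℕ → List Instr
  | .skip, _ => []
  | .const d v, _ => [.const d.idx v]
  | .mov d a, _ => [.const 24 0, .add d.idx a.idx 24]
  | .add d a b, _ => [.add d.idx a.idx b.idx]
  | .sub d a b, _ => [.sub d.idx a.idx b.idx]
  | .input d a, _ => [.input d.idx a.idx]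
  | .load d f a, _ => addressCode f a ++ [.load d.idx 24]
  | .store f a b, _ => addressCode f a ++ [.store 24 b.idx]
  | .seq c₁ c₂, o => c₁.compile o ++ c₂.compile (o + c₁.len)
  | .ifZero a c₁ c₂, o =>
    .jumpZero a.idx (o + c₂.len + 2) ::
      (c₂.compile (o + 1) ++ (.jump (o + c₁.len + c₂.len + 2) :: c₁.compile (o + c₂.len + 2)))

theorem Code.length_compile (c : Code) (o : ℕ) : (c.compile o).length = c.len := by
  induction c generalizing o <;> simp [Code.compile, Code.len, addressCode, *]
  omega

/-- A factor by which a loop-free program increases a bound at most, provided that the bound is not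
below the codes of the symbols. -/
def Code.growth : Code → ℕ
  | .skip => 1
  | .const _ v => v + 1
  | .mov _ _ => 1
  | .add _ _ _ => 2
  | .sub _ _ _ => 1
  | .input _ _ => 1
  | .load _ _ _ => 1
  | .store _ _ _ => 1
  | .seq c₁ c₂ => c₁.growth * c₂.growth
  | .ifZero _ c₁ c₂ => c₁.growth * c₂.growth

theorem Code.growth_pos (c : Code) : 1 ≤ c.growth := by
  induction c with
  | seq _ _ h₁ h₂ => exact Nat.mul_pos h₁ h₂
  | ifZero _ _ _ h₁ h₂ => exact Nat.mul_pos h₁ h₂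
  | _ => simp [Code.growth]

/-- The instructions `l` stand in the program `p` from position `o` on. -/
def CodeAt (p : Program) : ℕ → List Instr → Prop
  | _, [] => True
  | o, i :: l => p[o]? = some i ∧ CodeAt p (o + 1) l

theorem codeAt_append {p : Program} {o : ℕ} {l₁ l₂ : List Instr} :
    CodeAt p o (l₁ ++ l₂) ↔ CodeAt p o l₁ ∧ CodeAt p (o + l₁.length) l₂ := by
  induction l₁ generalizing o with
  | nil => simp [CodeAt]
  | cons i l ih => simp [CodeAt, ih, and_assoc, Nat.add_assoc, Nat.add_comm 1]

theorem codeAt_append_self (p l : List Instr) : CodeAt (p ++ l) p.length l := by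
  induction l generalizing p with
  | nil => trivial
  | cons i l ih => exact ⟨by simp, by simpa using ih (p ++ [i])⟩

theorem codeAt_self (p : Program) : CodeAt p 0 p := codeAt_append_self [] p

/-- `n` steps lead from `c` to `c'`, and no number above `Y` occurs on the way. -/
def Reach (p : Program) (inp : List ℕ) (Y : ℕ) (c : Config) (n : ℕ) (c' : Config) : Prop :=
  (step p inp)^[n] c = c' ∧ ∀ t ≤ n, ((step p inp)^[t] c).BoundedBy Y

theorem Reach.refl {p : Program} {inp : List ℕ} {Y : ℕ} {c : Config} (h : c.BoundedBy Y) :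
    Reach p inp Y c 0 c :=
  ⟨rfl, fun t ht => by obtain rfl : t = 0 := by omega
                       exact h⟩

theorem Reach.trans {p : Program} {inp : List ℕ} {Y : ℕ} {c₁ c₂ c₃ : Config} {m n : ℕ}
    (h₁ : Reach p inp Y c₁ m c₂) (h₂ : Reach p inp Y c₂ n c₃) :
    Reach p inp Y c₁ (m + n) c₃ := by
  refine ⟨by rw [Nat.add_comm, Function.iterate_add_apply, h₁.1, h₂.1], fun t ht => ?_⟩
  rcases le_total t m with h | h
  · exact h₁.2 t h
  · obtain ⟨k, rfl⟩ := Nat.exists_eq_add_of_le h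
    rw [Nat.add_comm, Function.iterate_add_apply, h₁.1]
    exact h₂.2 k (by omega)

theorem Reach.bounded {p : Program} {inp : List ℕ} {Y : ℕ} {c c' : Config} {n : ℕ}
    (h : Reach p inp Y c n c') : c'.BoundedBy Y :=
  h.1 ▸ h.2 n le_rfl

theorem Reach.step {p : Program} {inp : List ℕ} {Y : ℕ} {c : Config} {i : Instr}
    (hi : p[c.pc]? = some i) (h : c.BoundedBy Y) (h' : (i.exec inp c).BoundedBy Y) :
    Reach p inp Y c 1 (i.exec inp c) := by
  have hs : PrimalInfon.step p inp c = i.exec inp c := by simp [PrimalInfon.step, hi]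
  refine ⟨by simpa using hs, fun t ht => ?_⟩
  interval_cases t
  · exact h
  · simpa [hs] using h'

theorem Config.BoundedBy.update_reg {c : Config} {Y v : ℕ} (h : c.BoundedBy Y) (k d : ℕ)
    (hv : v ≤ Y) : Config.BoundedBy ⟨k, Function.update c.reg d v, c.mem⟩ Y := by
  refine ⟨fun e => ?_, h.2⟩
  simp only [Function.update_apply]
  split
  exacts [hv, h.1 e]

theorem Config.BoundedBy.update_mem {c : Config} {Y v : ℕ} (h : c.BoundedBy Y) (k d : ℕ)
    (hv : v ≤ Y) : Config.BoundedBy ⟨k, c.reg, Function.update c.mem d v⟩ Y := by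
  refine ⟨h.1, fun e => ?_⟩
  simp only [Function.update_apply]
  split
  exacts [hv, h.2 e]

/-- The configuration `c` represents the state `s`. -/
structure Refines (s : St) (c : Config) : Prop where
  reg : ∀ v : Var, c.reg v.idx = s.reg v
  mem : ∀ (f : Arr) (i : ℕ), c.mem (16 * i + f.idx) = s.fld f i

theorem Refines.set {s : St} {c : Config} (h : Refines s c) (k : ℕ) (d : Var) (v : ℕ) :
    Refines (s.set d v) ⟨k, Function.update c.reg d.idx v, c.mem⟩ := by
  refine ⟨fun e => ?_, h.mem⟩
  simp [Function.update_apply, Var.idx_injective.eq_iff, h.reg]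

theorem Refines.scratch {s : St} {c : Config} (h : Refines s c) (k d v : ℕ) (hd : 24 ≤ d) :
    Refines s ⟨k, Function.update c.reg d v, c.mem⟩ := by
  refine ⟨fun e => ?_, h.mem⟩
  have := e.idx_lt
  rw [← h.reg e]
  exact Function.update_of_ne (by omega) _ _

theorem Refines.put {s : St} {c : Config} (h : Refines s c) (k : ℕ) (f : Arr) (i v : ℕ) :
    Refines (s.put f i v) ⟨k, c.reg, Function.update c.mem (16 * i + f.idx) v⟩ := by
  refine ⟨h.reg, fun g j => ?_⟩
  have hf := f.idx_lt
  have hg := g.idx_lt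
  simp only [Function.update_apply, St.fld_put, h.mem]
  -- addresses of cells of different arrays differ modulo 16
  refine if_congr ⟨fun e => ⟨Arr.idx_injective ?_, ?_⟩, fun ⟨e₁, e₂⟩ => by rw [e₁, e₂]⟩ rfl rfl <;>
    omega

theorem Reach.const {p : Program} {inp : List ℕ} {Y : ℕ} {c : Config} {d v : ℕ}
    (hi : p[c.pc]? = some (.const d v)) (h : c.BoundedBy Y) (hv : v ≤ Y) :
    Reach p inp Y c 1 ⟨c.pc + 1, Function.update c.reg d v, c.mem⟩ :=
  Reach.step hi h (h.update_reg _ _ hv)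

theorem Reach.add {p : Program} {inp : List ℕ} {Y : ℕ} {c : Config} {d a b : ℕ}
    (hi : p[c.pc]? = some (.add d a b)) (h : c.BoundedBy Y) (hv : c.reg a + c.reg b ≤ Y) :
    Reach p inp Y c 1 ⟨c.pc + 1, Function.update c.reg d (c.reg a + c.reg b), c.mem⟩ :=
  Reach.step hi h (h.update_reg _ _ hv)

theorem reach_addressCode {p : Program} {inp : List ℕ} {Y : ℕ} {s : St} {c : Config} {f : Arr}
    {a : Var} (hp : CodeAt p c.pc (addressCode f a)) (hr : Refines s c) (hc : c.BoundedBy Y)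
    (hY : 16 * s.reg a + 16 ≤ Y) :
    ∃ c', Reach p inp Y c 6 c' ∧ c'.pc = c.pc + 6 ∧ Refines s c' ∧
      c'.reg 24 = 16 * s.reg a + f.idx := by
  have hf := f.idx_lt
  have ha := hr.reg a
  obtain ⟨h0, h1, h2, h3, h4, h5, -⟩ := hp
  have r0 := Reach.add (inp := inp) (Y := Y) h0 hc (by omega)
  have r1 := Reach.add (inp := inp) h1 r0.bounded (by simp; omega)
  have r2 := Reach.add (inp := inp) h2 r1.bounded (by simp; omega)
  have r3 := Reach.add (inp := inp) h3 r2.bounded (by simp; omega)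
  have r4 := Reach.const (inp := inp) h4 r3.bounded (by omega)
  have r5 := Reach.add (inp := inp) h5 r4.bounded (by simp; omega)
  refine ⟨_, ((((r0.trans r1).trans r2).trans r3).trans r4).trans r5, rfl, ?_, ?_⟩
  · exact (((((hr.scratch _ 24 _ le_rfl).scratch _ 24 _ le_rfl).scratch _ 24 _ le_rfl).scratch
      _ 24 _ le_rfl).scratch _ 25 _ (by norm_num)).scratch _ 24 _ le_rfl
  · simp
    omega

/-- Compilation is correct: the compiled program has the effect of the loop-free program, takes no
more steps than it has instructions, and does not exceed a constant multiple of the initial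
bound. The number `11` is the greatest code of a symbol; the factor `32` is due to the computation
of addresses. -/
theorem Code.reach_compile {p : Program} {inp : List ℕ} {Y : ℕ} (hinp : ∀ a ∈ inp, a ≤ 11)
    (code : Code) {X : ℕ} {s : St} {c : Config} (hp : CodeAt p c.pc (code.compile c.pc))
    (hr : Refines s c) (hc : c.BoundedBy Y) (hs : s.Bdd X) (hX : 11 ≤ X)
    (hY : 32 * (code.growth * X) ≤ Y) :
    ∃ n ≤ code.len, ∃ c', Reach p inp Y c n c' ∧ c'.pc = c.pc + code.len ∧
      Refines (code.eval inp s) c' ∧ (code.eval inp s).Bdd (code.growth * X) := by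
  induction code generalizing X s c with
  | skip =>
    exact ⟨0, le_rfl, c, Reach.refl hc, rfl, hr, by simpa [Code.growth, Code.eval] using hs⟩
  | const d v =>
    have hv : v ≤ (v + 1) * X := by nlinarith
    simp only [Code.growth] at hY ⊢
    exact ⟨1, le_rfl, _, Reach.const hp.1 hc (by omega), rfl, hr.set _ _ _,
      (hs.mono (by nlinarith)).set _ hv⟩
  | mov d a =>
    simp only [Code.growth, Code.len] at hY ⊢
    have ha := hs.1 a
    have hra := hr.reg a
    have hlt := a.idx_lt
    have r0 := Reach.const (inp := inp) hp.1 hc (by omega)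
    have f0 := hr.scratch (c.pc + 1) 24 0 le_rfl
    have e : Function.update c.reg 24 0 a.idx + Function.update c.reg 24 0 24 = s.reg a := by
      rw [Function.update_of_ne (by omega)]
      simpa using hra
    have r1 := Reach.add (inp := inp) hp.2.1 r0.bounded (by simp only [e]; omega)
    simp only [e] at r1
    exact ⟨2, le_rfl, _, r0.trans r1, rfl, f0.set _ _ _,
      (hs.mono (by omega)).set _ (by omega)⟩
  | add d a b =>
    simp only [Code.growth, Code.len] at hY ⊢
    have h₁ := hs.1 a
    have h₂ := hs.1 b
    have r := Reach.add (inp := inp) hp.1 hc (by rw [hr.reg, hr.reg]; omega)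
    rw [hr.reg, hr.reg] at r
    exact ⟨1, le_rfl, _, r, rfl, hr.set _ _ _, (hs.mono (by omega)).set _ (by omega)⟩
  | sub d a b =>
    simp only [Code.growth, Code.len] at hY ⊢
    have h₁ := hs.1 a
    have r := Reach.step (inp := inp) hp.1 hc
      (hc.update_reg (c.pc + 1) d.idx (v := c.reg a.idx - c.reg b.idx) (by rw [hr.reg]; omega))
    rw [Instr.exec, hr.reg, hr.reg] at r
    exact ⟨1, le_rfl, _, r, rfl, hr.set _ _ _, (hs.mono (by omega)).set _ (by omega)⟩
  | input d a =>
    simp only [Code.growth, Code.len] at hY ⊢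
    have hle : inp.getD (s.reg a) 0 ≤ 11 := by
      rw [List.getD_eq_getElem?_getD]
      cases h : inp[s.reg a]? with
      | none => simp
      | some x => exact hinp x (List.mem_of_getElem? h)
    have r := Reach.step (inp := inp) hp.1 hc
      (hc.update_reg (c.pc + 1) d.idx (v := inp.getD (c.reg a.idx) 0) (by rw [hr.reg]; omega))
    rw [Instr.exec, hr.reg] at r
    exact ⟨1, le_rfl, _, r, rfl, hr.set _ _ _, (hs.mono (by omega)).set _ (by omega)⟩
  | load d f a =>
    simp only [Code.growth, Code.len] at hY ⊢
    have h₁ := hs.1 a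
    have h₂ := hs.2 f (s.reg a)
    obtain ⟨hp₁, hp₂⟩ := codeAt_append.1 hp
    obtain ⟨c', r, hpc, hr', h24⟩ := reach_addressCode (inp := inp) hp₁ hr hc (by omega)
    have hm := hr'.mem f (s.reg a)
    rw [← h24] at hm
    have r' := Reach.step (inp := inp) (i := .load d.idx 24) (hpc ▸ hp₂.1) r.bounded
      (r.bounded.update_reg _ _ (by rw [hm]; omega))
    rw [Instr.exec, hm] at r'
    exact ⟨7, le_rfl, _, r.trans r', by simp [hpc], hr'.set _ _ _,
      (hs.mono (by omega)).set _ (by omega)⟩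
  | store f a b =>
    simp only [Code.growth, Code.len] at hY ⊢
    have h₁ := hs.1 a
    have h₂ := hs.1 b
    obtain ⟨hp₁, hp₂⟩ := codeAt_append.1 hp
    obtain ⟨c', r, hpc, hr', h24⟩ := reach_addressCode (inp := inp) hp₁ hr hc (by omega)
    have hm := hr'.reg b
    have r' := Reach.step (inp := inp) (i := .store 24 b.idx) (hpc ▸ hp₂.1) r.bounded
      (r.bounded.update_mem _ _ (by rw [hm]; omega))
    rw [Instr.exec, hm, h24] at r'
    exact ⟨7, le_rfl, _, r.trans r', by simp [hpc], hr'.put _ _ _ _,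
      (hs.mono (by omega)).put _ _ (by omega)⟩
  | seq c₁ c₂ ih₁ ih₂ =>
    simp only [Code.growth, Code.len] at hY ⊢
    have hg₁ := c₁.growth_pos
    have hg₂ := c₂.growth_pos
    obtain ⟨hp₁, hp₂⟩ := codeAt_append.1 hp
    have hle : c₁.growth * X ≤ c₁.growth * c₂.growth * X :=
      Nat.mul_le_mul_right _ (Nat.le_mul_of_pos_right _ hg₂)
    obtain ⟨n₁, hn₁, d₁, r₁, hpc₁, hr₁, hs₁⟩ := ih₁ hp₁ hr hc hs hX (by omega)
    rw [Code.length_compile, ← hpc₁] at hp₂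
    have e : c₂.growth * (c₁.growth * X) = c₁.growth * c₂.growth * X := by ring
    obtain ⟨n₂, hn₂, d₂, r₂, hpc₂, hr₂, hs₂⟩ :=
      ih₂ hp₂ hr₁ r₁.bounded hs₁ (hX.trans (Nat.le_mul_of_pos_left _ hg₁)) (e ▸ hY)
    exact ⟨n₁ + n₂, by omega, d₂, r₁.trans r₂, by omega, hr₂, e ▸ hs₂⟩
  | ifZero a c₁ c₂ ih₁ ih₂ =>
    simp only [Code.growth, Code.len] at hY ⊢
    have hg₁ := c₁.growth_pos
    have hg₂ := c₂.growth_pos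
    have hle₁ : c₁.growth * X ≤ c₁.growth * c₂.growth * X :=
      Nat.mul_le_mul_right _ (Nat.le_mul_of_pos_right _ hg₂)
    have hle₂ : c₂.growth * X ≤ c₁.growth * c₂.growth * X :=
      Nat.mul_le_mul_right _ (Nat.le_mul_of_pos_left _ hg₁)
    obtain ⟨hp₀, hp'⟩ := hp
    obtain ⟨hp₂, hpj, hp₁⟩ := codeAt_append.1 hp'
    rw [Code.length_compile] at hpj hp₁
    have r₀ := Reach.step (inp := inp) hp₀ hc hc
    rw [Instr.exec, hr.reg] at r₀
    by_cases h0 : s.reg a = 0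
    · rw [if_pos h0] at r₀
      obtain ⟨n, hn, d, r, hpc, hr', hs'⟩ := ih₁ (X := X) (s := s)
        (c := ⟨c.pc + c₂.len + 2, c.reg, c.mem⟩)
        (by convert hp₁ using 1; simp only; omega) ⟨hr.reg, hr.mem⟩ r₀.bounded hs hX (by omega)
      refine ⟨1 + n, by omega, d, r₀.trans r, by rw [hpc]; simp only; omega, ?_, ?_⟩
      · simpa [Code.eval, h0] using hr'
      · simpa [Code.eval, h0] using hs'.mono hle₁
    · rw [if_neg h0] at r₀
      obtain ⟨n, hn, d, r, hpc, hr', hs'⟩ := ih₂ (X := X) (s := s)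
        (c := ⟨c.pc + 1, c.reg, c.mem⟩) hp₂ ⟨hr.reg, hr.mem⟩ r₀.bounded hs hX (by omega)
      rw [← hpc] at hpj
      have r₃ := Reach.step (inp := inp) hpj r.bounded r.bounded
      refine ⟨1 + n + 1, by omega, _, (r₀.trans r).trans r₃, ?_, ?_, ?_⟩
      · simp only [Instr.exec]; omega
      · rw [Code.eval, if_neg h0]
        exact ⟨hr'.reg, hr'.mem⟩
      · simpa [Code.eval, h0] using hs'.mono hle₂

/-! ### Loops -/

/-- The instructions of a loop that runs the loop-free program `body` while `a` is not zero. -/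
def loopCode (a : Var) (body : Code) (o : ℕ) : List Instr :=
  .jumpZero a.idx (o + body.len + 2) :: (body.compile (o + 1) ++ [.jump o])

theorem length_loopCode (a : Var) (body : Code) (o : ℕ) :
    (loopCode a body o).length = body.len + 2 := by
  simp [loopCode, Code.length_compile]

/-- A loop whose invariant carries a decreasing counter `m` takes `O(m)` steps. -/
theorem reach_loopCode {p : Program} {inp : List ℕ} {X Y : ℕ} (hinp : ∀ a ∈ inp, a ≤ 11)
    (a : Var) (body : Code) (I : ℕ → St → Prop) (hbd : ∀ m s, I m s → s.Bdd X) (hX : 11 ≤ X)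
    (hstep : ∀ m s, I m s → s.reg a ≠ 0 → ∃ m' < m, I m' (body.eval inp s))
    (hY : 32 * (body.growth * X) ≤ Y) (m : ℕ) {s : St} {c : Config}
    (hI : I m s) (hp : CodeAt p c.pc (loopCode a body c.pc)) (hr : Refines s c)
    (hc : c.BoundedBy Y) :
    ∃ n ≤ (body.len + 2) * (m + 1), ∃ c' s' m', Reach p inp Y c n c' ∧
      c'.pc = c.pc + (body.len + 2) ∧ Refines s' c' ∧ I m' s' ∧ s'.reg a = 0 := by
  induction m using Nat.strong_induction_on generalizing s c with
  | _ m ih =>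
    obtain ⟨hp₀, hp'⟩ := id hp
    obtain ⟨hp₁, hpj, -⟩ := codeAt_append.1 hp'
    rw [Code.length_compile] at hpj
    have r₀ := Reach.step (inp := inp) hp₀ hc hc
    rw [Instr.exec, hr.reg] at r₀
    by_cases h0 : s.reg a = 0
    · rw [if_pos h0] at r₀
      exact ⟨1, by nlinarith, _, s, m, r₀, by simp only; omega, ⟨hr.reg, hr.mem⟩, hI, h0⟩
    · rw [if_neg h0] at r₀
      obtain ⟨m', hm, hI'⟩ := hstep m s hI h0
      obtain ⟨n, hn, d, r, hpc, hr', -⟩ := body.reach_compile hinp (X := X) (s := s)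
        (c := ⟨c.pc + 1, c.reg, c.mem⟩) hp₁ ⟨hr.reg, hr.mem⟩ r₀.bounded (hbd m s hI) hX hY
      rw [← hpc] at hpj
      have r₃ := Reach.step (inp := inp) hpj r.bounded r.bounded
      obtain ⟨n', hn', c', s', k, r', hpc', hrest⟩ := ih m' hm (c := ⟨c.pc, d.reg, d.mem⟩) hI'
        hp ⟨hr'.reg, hr'.mem⟩ r₃.bounded
      refine ⟨1 + n + 1 + n', ?_, c', s', k, ((r₀.trans r).trans r₃).trans r', hpc', hrest⟩
      have : (body.len + 2) * (m' + 1 + 1) ≤ (body.len + 2) * (m + 1) :=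
        Nat.mul_le_mul_left _ (by omega)
      rw [Nat.mul_succ] at this
      omega

/-! ### Adjacency lists of Horn clauses -/

/-- The states `s` and `s'` agree except for the variables in `V` and the arrays in `A`. -/
structure AgreeOff (V : List Var) (A : List Arr) (s s' : St) : Prop where
  reg : ∀ v ∉ V, s'.reg v = s.reg v
  fld : ∀ f ∉ A, s'.fld f = s.fld f

theorem AgreeOff.trans {V : List Var} {A : List Arr} {s₁ s₂ s₃ : St} (h₁ : AgreeOff V A s₁ s₂)
    (h₂ : AgreeOff V A s₂ s₃) : AgreeOff V A s₁ s₃ :=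
  ⟨fun v hv => (h₂.reg v hv).trans (h₁.reg v hv), fun f hf => (h₂.fld f hf).trans (h₁.fld f hf)⟩

theorem AgreeOff.mono {V V' : List Var} {A A' : List Arr} {s s' : St} (h : AgreeOff V A s s')
    (hV : V ⊆ V') (hA : A ⊆ A') : AgreeOff V' A' s s' :=
  ⟨fun v hv => h.reg v fun h' => hv (hV h'), fun f hf => h.fld f fun h' => hf (hA h')⟩

/-- The linked list with head `e` holds the pairs in `L`, in cells with numbers below `b`; the
number `0` is the empty list. -/
def Chain (s : St) (b : ℕ) : List (ℕ × ℕ) → ℕ → Prop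
  | [], e => e = 0
  | (q, r) :: L, e =>
    e ≠ 0 ∧ e < b ∧ s.fld .other e = q ∧ s.fld .target e = r ∧ Chain s b L (s.fld .next e)

theorem Chain.congr {s s' : St} {b b' : ℕ} (hb : b ≤ b')
    (hs : ∀ i < b, s'.fld .other i = s.fld .other i ∧ s'.fld .target i = s.fld .target i ∧
      s'.fld .next i = s.fld .next i) {L : List (ℕ × ℕ)} {e : ℕ} (h : Chain s b L e) :
    Chain s' b' L e := by
  induction L generalizing e with
  | nil => exact h
  | cons x L ih =>
    obtain ⟨h0, h1, h2, h3, h4⟩ := h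
    obtain ⟨g1, g2, g3⟩ := hs e h1
    exact ⟨h0, by omega, g1.trans h2, g2.trans h3, g3 ▸ ih h4⟩

/-- The infons with numbers `x` and `y` in the list `ns` yield the one with number `z`. -/
def Entails (ns : List Infon) (x y z : ℕ) : Prop :=
  ∃ φ ψ χ, ns[x]? = some φ ∧ ns[y]? = some ψ ∧ ns[z]? = some χ ∧
    ∀ Γ, Derives .PBotW Γ φ → Derives .PBotW Γ ψ → Derives .PBotW Γ χ

theorem getElem?_of_prefix {α : Type*} {l l' : List α} (h : l <+: l') {i : ℕ} {a : α}
    (ha : l[i]? = some a) : l'[i]? = some a := by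
  obtain ⟨t, rfl⟩ := h
  rw [List.getElem?_append_left (List.getElem?_eq_some_iff.1 ha).1, ha]

theorem lt_of_getElem?_eq_some {α : Type*} {l : List α} {i : ℕ} {a : α} (h : l[i]? = some a) :
    i < l.length :=
  (List.getElem?_eq_some_iff.1 h).1

theorem Entails.mono {ns ns' : List Infon} (hns : ns <+: ns') {x y z : ℕ}
    (h : Entails ns x y z) : Entails ns' x y z := by
  obtain ⟨φ, ψ, χ, h1, h2, h3, h4⟩ := h
  exact ⟨φ, ψ, χ, getElem?_of_prefix hns h1, getElem?_of_prefix hns h2,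
    getElem?_of_prefix hns h3, h4⟩

theorem Entails.symm {ns : List Infon} {x y z : ℕ} (h : Entails ns x y z) :
    Entails ns y x z := by
  obtain ⟨φ, ψ, χ, h1, h2, h3, h4⟩ := h
  exact ⟨ψ, φ, χ, h2, h1, h3, fun Γ a b => h4 Γ b a⟩

/-- The arrays hold, for every `x`, the list `adj x` of the pairs `(y, z)` that stand for a clause
`x, y → z`. Cells are numbered from `1`, so at most `ecnt - 1` of them are in use. -/
structure Edges (ns : List Infon) (adj : ℕ → List (ℕ × ℕ)) (s : St) : Prop where
  chain : ∀ x, Chain s (s.reg .ecnt) (adj x) (s.fld .first x)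
  total : ∀ F : Finset ℕ, ∑ x ∈ F, (adj x).length + 1 ≤ s.reg .ecnt
  sound : ∀ x, ∀ e ∈ adj x, Entails ns x e.1 e.2

theorem Edges.congr {ns : List Infon} {adj : ℕ → List (ℕ × ℕ)} {s s' : St}
    (h : Edges ns adj s) (hreg : s'.reg .ecnt = s.reg .ecnt)
    (hfld : ∀ f ∈ [Arr.first, .other, .target, .next], s'.fld f = s.fld f) :
    Edges ns adj s' := by
  refine ⟨fun x => ?_, hreg ▸ h.total, h.sound⟩
  rw [hreg, hfld .first (by decide)]
  refine (h.chain x).congr le_rfl fun i _ => ?_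
  simp [hfld]

theorem Edges.mono {ns ns' : List Infon} (hns : ns <+: ns') {adj : ℕ → List (ℕ × ℕ)} {s : St}
    (h : Edges ns adj s) : Edges ns' adj s :=
  ⟨h.chain, h.total, fun x e he => (h.sound x e he).mono hns⟩

/-- Put the pair `(q, r)` into the list of `p`. -/
def addEdge (p q r : Var) : Code :=
  .store .other .ecnt q ;; .store .target .ecnt r ;; .load .tmp .first p ;;
    .store .next .ecnt .tmp ;; .store .first p .ecnt ;; .add .ecnt .ecnt .one

/-- Record the Horn clause `p, q → r`, both with its first and with its second premise. -/
def addClause (p q r : Var) : Code := addEdge p q r ;; addEdge q p r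

/-- Only the adjacency lists have changed, and `k` cells were allocated. -/
structure EdgeStep (k : ℕ) (s s' : St) : Prop extends
    AgreeOff [.ecnt, .tmp] [.first, .other, .target, .next] s s' where
  ecnt : s'.reg .ecnt = s.reg .ecnt + k
  bdd : ∀ X, s.Bdd X → s.reg .ecnt + k ≤ X → s'.Bdd X

theorem EdgeStep.trans {j k : ℕ} {s₁ s₂ s₃ : St} (h₁ : EdgeStep j s₁ s₂)
    (h₂ : EdgeStep k s₂ s₃) : EdgeStep (j + k) s₁ s₃ := by
  refine ⟨h₁.toAgreeOff.trans h₂.toAgreeOff, ?_, fun X hX hle => ?_⟩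
  · rw [h₂.ecnt, h₁.ecnt, add_assoc]
  · exact h₂.bdd X (h₁.bdd X hX (by omega)) (by rw [h₁.ecnt]; omega)

theorem edgeStep_addEdge {inp : List ℕ} {s : St} {p q r : Var}
    (hone : s.reg .one = 1) : EdgeStep 1 s ((addEdge p q r).eval inp s) := by
  refine ⟨⟨fun v hv => ?_, fun f hf => ?_⟩, ?_, fun X hX hle => ?_⟩
  · simp only [List.mem_cons, List.not_mem_nil, or_false, not_or] at hv
    simp [addEdge, Code.eval, hv.1, hv.2]
  · simp only [List.mem_cons, List.not_mem_nil, or_false, not_or] at hf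
    funext i
    simp [addEdge, Code.eval, hf]
  · simp [addEdge, Code.eval, hone]
  · have b := hX.1
    have c := hX.2
    simp only [addEdge, Code.eval]
    refine St.Bdd.set (St.Bdd.put (St.Bdd.put (St.Bdd.set ((hX.put _ _ ?_).put _ _ ?_) _ ?_)
      _ _ ?_) _ _ ?_) _ ?_ <;> simp [b, c, hone, hle]

theorem Edges.eval_addEdge {inp : List ℕ} {ns : List Infon} {adj : ℕ → List (ℕ × ℕ)} {s : St}
    (h : Edges ns adj s) {p q r : Var} (hp : p ∉ [Var.ecnt, .tmp]) (hone : s.reg .one = 1)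
    (he : Entails ns (s.reg p) (s.reg q) (s.reg r)) :
    Edges ns (Function.update adj (s.reg p) ((s.reg q, s.reg r) :: adj (s.reg p)))
      ((addEdge p q r).eval inp s) := by
  simp only [List.mem_cons, List.not_mem_nil, or_false, not_or] at hp
  have hpos : 1 ≤ s.reg .ecnt := by simpa using h.total ∅
  have hold : ∀ x, Chain ((addEdge p q r).eval inp s) (s.reg .ecnt + 1) (adj x)
      (s.fld .first x) := by
    refine fun x => (h.chain x).congr (by omega) fun i hi => ?_
    simp [addEdge, Code.eval, hi.ne]
  refine ⟨fun x => ?_, fun F => ?_, fun x e hx => ?_⟩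
  · have e1 : ((addEdge p q r).eval inp s).reg .ecnt = s.reg .ecnt + 1 := by
      simp [addEdge, Code.eval, hone]
    have e2 : ((addEdge p q r).eval inp s).fld .first x =
        if x = s.reg p then s.reg .ecnt else s.fld .first x := by
      simp [addEdge, Code.eval, hp.2]
    rw [e1, e2, Function.update_apply]
    by_cases hx : x = s.reg p
    · rw [if_pos hx, if_pos hx]
      refine ⟨by omega, by omega, ?_, ?_, ?_⟩
      · simp [addEdge, Code.eval]
      · simp [addEdge, Code.eval]
      · have e3 : ((addEdge p q r).eval inp s).fld .next (s.reg .ecnt) =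
            s.fld .first (s.reg p) := by
          simp [addEdge, Code.eval]
        exact e3 ▸ hold (s.reg p)
    · rw [if_neg hx, if_neg hx]
      exact hold x
  · have e1 : ((addEdge p q r).eval inp s).reg .ecnt = s.reg .ecnt + 1 := by
      simp [addEdge, Code.eval, hone]
    rw [e1]
    have hF := h.total F
    have hle : ∑ x ∈ F, (Function.update adj (s.reg p)
        ((s.reg q, s.reg r) :: adj (s.reg p)) x).length ≤
        ∑ x ∈ F, ((adj x).length + if x = s.reg p then 1 else 0) := by
      refine Finset.sum_le_sum fun x _ => ?_
      rw [Function.update_apply]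
      split
      · simp_all
      · simp
    have hone' : ∑ x ∈ F, (if x = s.reg p then 1 else 0) ≤ 1 := by
      rw [Finset.sum_ite_eq']
      split <;> simp
    rw [Finset.sum_add_distrib] at hle
    omega
  · rw [Function.update_apply] at hx
    split at hx
    · next hxp =>
      rcases List.mem_cons.1 hx with rfl | hx
      · rw [hxp]
        exact he
      · rw [hxp]
        exact h.sound _ _ hx
    · exact h.sound _ _ hx

/-- The clause `p, q → r` is recorded with both of its premises. -/
def Clause (adj : ℕ → List (ℕ × ℕ)) (p q r : ℕ) : Prop := (q, r) ∈ adj p ∧ (p, r) ∈ adj q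

theorem Clause.mono {adj adj' : ℕ → List (ℕ × ℕ)} (h : ∀ x, adj x ⊆ adj' x) {p q r : ℕ}
    (hc : Clause adj p q r) : Clause adj' p q r :=
  ⟨h _ hc.1, h _ hc.2⟩

theorem subset_update_cons (adj : ℕ → List (ℕ × ℕ)) (p : ℕ) (e : ℕ × ℕ) (x : ℕ) :
    adj x ⊆ Function.update adj p (e :: adj p) x := by
  rw [Function.update_apply]
  split
  · next h => exact h ▸ List.subset_cons_self _ _
  · exact List.Subset.refl _

theorem Edges.eval_addClause {inp : List ℕ} {ns : List Infon} {adj : ℕ → List (ℕ × ℕ)} {s : St}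
    (h : Edges ns adj s) {p q r : Var} (hp : p ∉ [Var.ecnt, .tmp]) (hq : q ∉ [Var.ecnt, .tmp])
    (hr : r ∉ [Var.ecnt, .tmp]) (hone : s.reg .one = 1)
    (he : Entails ns (s.reg p) (s.reg q) (s.reg r)) :
    ∃ adj', (∀ x, adj x ⊆ adj' x) ∧ Clause adj' (s.reg p) (s.reg q) (s.reg r) ∧
      Edges ns adj' ((addClause p q r).eval inp s) ∧
      EdgeStep 2 s ((addClause p q r).eval inp s) := by
  have s1 := edgeStep_addEdge (inp := inp) (p := p) (q := q) (r := r) hone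
  have h1 := h.eval_addEdge (inp := inp) hp hone he
  set s' := (addEdge p q r).eval inp s
  have e1 := s1.reg p hp
  have e2 := s1.reg q hq
  have e3 := s1.reg r hr
  have hone' : s'.reg .one = 1 := (s1.reg .one (by decide)).trans hone
  have s2 := edgeStep_addEdge (inp := inp) (p := q) (q := p) (r := r) hone'
  have h2 := h1.eval_addEdge (inp := inp) (p := q) (q := p) (r := r) hq hone'
    (by rw [e1, e2, e3]; exact he.symm)
  refine ⟨_, fun x => List.Subset.trans (subset_update_cons _ _ _ x)
    (subset_update_cons _ _ _ x), ⟨?_, ?_⟩, h2, s1.trans s2⟩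
  · exact subset_update_cons _ _ _ _ (by simp)
  · simp [e1, e2, e3]

/-! ### Hash-consing -/

/-- The compound infon `φ` with the principal operation of tag `t` has the immediate parts with
numbers `l` and `r` in `ns`. The tags `1` and `2` stand for the connectives; tag `0` prolongs the
name of an atom by a bit, which is given by `r` itself. -/
inductive Node (ns : List Infon) : ℕ → ℕ → ℕ → Infon → Prop
  | bit {l : ℕ} {a : List Bool} (b : Bool) (h : ns[l]? = some (.atom a)) :
      Node ns 0 l b.toNat (.atom (a ++ [b]))
  | conj {l r : ℕ} {φ ψ : Infon} (hl : ns[l]? = some φ) (hr : ns[r]? = some ψ) :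
      Node ns 1 l r (.conj φ ψ)
  | imp {l r : ℕ} {φ ψ : Infon} (hl : ns[l]? = some φ) (hr : ns[r]? = some ψ) :
      Node ns 2 l r (.imp φ ψ)

theorem Node.mono {ns ns' : List Infon} (hns : ns <+: ns') {t l r : ℕ} {φ : Infon}
    (h : Node ns t l r φ) : Node ns' t l r φ := by
  cases h with
  | bit b h => exact .bit b (getElem?_of_prefix hns h)
  | conj hl hr => exact .conj (getElem?_of_prefix hns hl) (getElem?_of_prefix hns hr)
  | imp hl hr => exact .imp (getElem?_of_prefix hns hl) (getElem?_of_prefix hns hr)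

theorem index_unique {ns : List Infon} (hnd : ns.Nodup) {i j : ℕ} {φ : Infon}
    (hi : ns[i]? = some φ) (hj : ns[j]? = some φ) : i = j :=
  (List.getElem?_inj (lt_of_getElem?_eq_some hi) hnd).1 (hi.trans hj.symm)

theorem Node.unique {ns : List Infon} (hnd : ns.Nodup) {t l r t' l' r' : ℕ} {φ : Infon}
    (h : Node ns t l r φ) (h' : Node ns t' l' r' φ) : t = t' ∧ l = l' ∧ r = r' := by
  generalize hψ : φ = ψ at h'
  cases h with
  | bit b h =>
    cases h' with
    | bit b' h' =>
      simp only [Infon.atom.injEq, List.append_singleton_inj] at hψ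
      obtain ⟨rfl, rfl⟩ := hψ
      exact ⟨rfl, index_unique hnd h h', rfl⟩
    | conj => cases hψ
    | imp => cases hψ
  | conj hl hr =>
    cases h' with
    | bit => cases hψ
    | conj hl' hr' =>
      cases hψ
      exact ⟨rfl, index_unique hnd hl hl', index_unique hnd hr hr'⟩
    | imp => cases hψ
  | imp hl hr =>
    cases h' with
    | bit => cases hψ
    | conj => cases hψ
    | imp hl' hr' =>
      cases hψ
      exact ⟨rfl, index_unique hnd hl hl', index_unique hnd hr hr'⟩

theorem Node.det {ns : List Infon} {t l r : ℕ} {φ ψ : Infon}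
    (h : Node ns t l r φ) (h' : Node ns t l r ψ) : φ = ψ := by
  cases h with
  | bit b h =>
    generalize hr : b.toNat = r at h'
    cases h' with
    | bit b' h' =>
      obtain rfl : b = b' := by cases b <;> cases b' <;> simp_all
      simp_all
  | conj => cases h' with | conj => simp_all
  | imp => cases h' with | imp => simp_all

theorem Node.tag_lt {ns : List Infon} {t l r : ℕ} {φ : Infon} (h : Node ns t l r φ) : t < 3 := by
  cases h <;> decide

theorem Node.left_lt {ns : List Infon} {t l r : ℕ} {φ : Infon} (h : Node ns t l r φ) :
    l < ns.length := by
  cases h <;> exact lt_of_getElem?_eq_some ‹_›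

theorem Node.right_lt {ns : List Infon} {t l r : ℕ} {φ : Infon} (h : Node ns t l r φ) :
    r < ns.length ∨ r < 2 := by
  cases h with
  | bit b h => exact .inr (by cases b <;> decide)
  | conj _ h => exact .inl (lt_of_getElem?_eq_some h)
  | imp _ h => exact .inl (lt_of_getElem?_eq_some h)

/-- The index of the table of compound infons for the tag `t` and the parts `l` and `r`. -/
def tableKey (M t l r : ℕ) : ℕ := 4 * (l * M + r) + t

theorem tableKey_inj {M t l r t' l' r' : ℕ} (ht : t < 4) (ht' : t' < 4) (hr : r < M)
    (hr' : r' < M) (h : tableKey M t l r = tableKey M t' l' r') : t = t' ∧ l = l' ∧ r = r' := by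
  unfold tableKey at h
  have ht : t = t' := by omega
  have h' : l * M + r = l' * M + r' := by omega
  have hM : 0 < M := by omega
  have hl : l = l' := by
    have := congrArg (· / M) h'
    simpa [Nat.mul_comm _ M, Nat.mul_add_div hM, Nat.div_eq_of_lt hr, Nat.div_eq_of_lt hr']
      using this
  subst hl
  exact ⟨ht, rfl, by omega⟩

/-- The table index is a number of quadratic size. -/
theorem tableKey_lt {M t l r : ℕ} (ht : t < 4) (hl : l < M) (hr : r < M) :
    tableKey M t l r < 4 * M * M := by
  unfold tableKey
  have : (l + 1) * M ≤ M * M := Nat.mul_le_mul_right _ hl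
  rw [Nat.add_mul] at this
  rw [mul_assoc]
  omega

/-- The clauses of a compound infon with number `n`. The last one is the rule for the universal
key, as `⊥` has the number `1`. -/
def NodeClauses (adj : ℕ → List (ℕ × ℕ)) (n t l r : ℕ) : Prop :=
  (t = 1 → Clause adj n n l ∧ Clause adj n n r ∧ Clause adj l r n) ∧
    (t = 2 → Clause adj r r n ∧ Clause adj l n r ∧ Clause adj 1 n r)

theorem NodeClauses.mono {adj adj' : ℕ → List (ℕ × ℕ)} (h : ∀ x, adj x ⊆ adj' x) {n t l r : ℕ}
    (hc : NodeClauses adj n t l r) : NodeClauses adj' n t l r :=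
  ⟨fun ht => ⟨(hc.1 ht).1.mono h, (hc.1 ht).2.1.mono h, (hc.1 ht).2.2.mono h⟩,
    fun ht => ⟨(hc.2 ht).1.mono h, (hc.2 ht).2.1.mono h, (hc.2 ht).2.2.mono h⟩⟩

/-- The state represents the list `ns` of distinct infons, in which the infons are numbered,
together with the clauses of these infons. With a compound infon, the list contains its parts, and
with an atom all atoms whose names are prefixes of its name. The number `M`, by which the rows of
the table are spaced, is meant to be at least the length of the list; a table entry `0`
means that the compound infon is not in the list. -/
structure Heap (M : ℕ) (ns : List Infon) (adj : ℕ → List (ℕ × ℕ)) (s : St) : Prop where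
  one : s.reg .one = 1
  size : s.reg .size = M
  cnt : s.reg .cnt = ns.length
  row : s.reg .row = ns.length * M
  rows : ∀ k < ns.length, s.fld .row k = k * M
  edges : Edges ns adj s
  ecnt_le : s.reg .ecnt ≤ 6 * ns.length
  nodup : ns.Nodup
  top : ns[0]? = some .top
  bot : ns[1]? = some .bot
  var : ns[2]? = some (.atom [])
  table : ∀ t l r, t < 4 → r < M → s.fld .table (tableKey M t l r) ≠ 0 →
    ∃ φ, Node ns t l r φ ∧ ns[s.fld .table (tableKey M t l r)]? = some φ
  node : ∀ n φ, 3 ≤ n → ns[n]? = some φ → ∃ t l r, Node ns t l r φ ∧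
    s.fld .table (tableKey M t l r) = n ∧ NodeClauses adj n t l r

theorem Heap.congr {M : ℕ} {ns : List Infon} {adj : ℕ → List (ℕ × ℕ)} {s s' : St}
    (h : Heap M ns adj s) (hreg : ∀ v ∈ [Var.one, .size, .cnt, .row, .ecnt], s'.reg v = s.reg v)
    (hfld : ∀ f ∈ [Arr.table, .row, .first, .other, .target, .next], s'.fld f = s.fld f) :
    Heap M ns adj s' := by
  have hedges := h.edges.congr (hreg .ecnt (by decide)) fun f hf => hfld f (by
    simp only [List.mem_cons] at hf ⊢; tauto)
  obtain ⟨h1, h2, h3, h4, h5, -, h7, h8, h9, h10, h11, h12, h13⟩ := h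
  constructor <;> simp_all

theorem Heap.three_le {M : ℕ} {ns : List Infon} {adj : ℕ → List (ℕ × ℕ)} {s : St}
    (h : Heap M ns adj s) : 3 ≤ ns.length :=
  lt_of_getElem?_eq_some h.var

/-- Record the clauses of the conjunction `cur` of `lhs` and `rhs`. -/
def conjClauses : Code :=
  addClause .cur .cur .lhs ;; addClause .cur .cur .rhs ;; addClause .lhs .rhs .cur

/-- Record the clauses of the implication `cur` from `lhs` to `rhs`; the variable `one` serves as
the number of `⊥`. -/
def impClauses : Code :=
  addClause .rhs .rhs .cur ;; addClause .lhs .cur .rhs ;; addClause .one .cur .rhs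

/-- Give the number `cnt` to the compound infon with the table index `key`. -/
def allocate : Code :=
  .mov .cur .cnt ;; .store .table .key .cur ;; .store .row .cur .row ;;
    .add .row .row .size ;; .add .cnt .cnt .one

/-- Record the clauses of the compound infon `cur`. -/
def nodeClauses : Code :=
  .ifZero .tag .skip (.sub .tmp .tag .one ;; .ifZero .tmp conjClauses impClauses)

/-- Set `key` to the table index for `tag`, `lhs` and `rhs`. -/
def computeKey : Code :=
  .load .key .row .lhs ;; .add .key .key .rhs ;; .add .key .key .key ;; .add .key .key .key ;;
    .add .key .key .tag

/-- Set `cur` to the number of the compound infon that is given by `tag`, `lhs` and `rhs`. -/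
def hashCons : Code :=
  computeKey ;; .load .cur .table .key ;; .ifZero .cur (allocate ;; nodeClauses) .skip

/-- Three clauses are recorded one after the other. -/
theorem Edges.eval_addClauses {inp : List ℕ} {ns : List Infon} {adj : ℕ → List (ℕ × ℕ)} {s : St}
    (h : Edges ns adj s) {p q r p' q' r' p'' q'' r'' : Var}
    (hv : ∀ v ∈ [p, q, r, p', q', r', p'', q'', r''], v ∉ [Var.ecnt, .tmp])
    (hone : s.reg .one = 1)
    (h1 : Entails ns (s.reg p) (s.reg q) (s.reg r))
    (h2 : Entails ns (s.reg p') (s.reg q') (s.reg r'))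
    (h3 : Entails ns (s.reg p'') (s.reg q'') (s.reg r'')) {c : Code}
    (hc : c = (addClause p q r ;; addClause p' q' r' ;; addClause p'' q'' r'')) :
    ∃ adj', (∀ x, adj x ⊆ adj' x) ∧ Clause adj' (s.reg p) (s.reg q) (s.reg r) ∧
      Clause adj' (s.reg p') (s.reg q') (s.reg r') ∧
      Clause adj' (s.reg p'') (s.reg q'') (s.reg r'') ∧
      Edges ns adj' (c.eval inp s) ∧ EdgeStep 6 s (c.eval inp s) := by
  subst hc
  simp only [List.forall_mem_cons] at hv
  obtain ⟨v1, v2, v3, v4, v5, v6, v7, v8, v9, -⟩ := hv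
  obtain ⟨a1, m1, c1, e1, t1⟩ := h.eval_addClause (inp := inp) v1 v2 v3 hone h1
  have r1 := t1.reg
  obtain ⟨a2, m2, c2, e2, t2⟩ := e1.eval_addClause (inp := inp) v4 v5 v6
    ((r1 .one (by decide)).trans hone) (by rwa [r1 _ v4, r1 _ v5, r1 _ v6])
  have r2 := (t1.trans t2).reg
  obtain ⟨a3, m3, c3, e3, t3⟩ := e2.eval_addClause (inp := inp) v7 v8 v9
    ((r2 .one (by decide)).trans hone) (by rwa [r2 _ v7, r2 _ v8, r2 _ v9])
  rw [r1 _ v4, r1 _ v5, r1 _ v6] at c2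
  rw [r2 _ v7, r2 _ v8, r2 _ v9] at c3
  exact ⟨a3, fun x => List.Subset.trans (List.Subset.trans (m1 x) (m2 x)) (m3 x),
    (c1.mono m2).mono m3, c2.mono m3, c3, e3, (t1.trans t2).trans t3⟩

theorem Edges.eval_nodeClauses {inp : List ℕ} {ns : List Infon} {adj : ℕ → List (ℕ × ℕ)} {s : St}
    (h : Edges ns adj s) (hone : s.reg .one = 1) (hbot : ns[1]? = some .bot) {φ : Infon}
    (hN : Node ns (s.reg .tag) (s.reg .lhs) (s.reg .rhs) φ) (hcur : ns[s.reg .cur]? = some φ) :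
    ∃ adj', (∀ x, adj x ⊆ adj' x) ∧
      NodeClauses adj' (s.reg .cur) (s.reg .tag) (s.reg .lhs) (s.reg .rhs) ∧
      Edges ns adj' (nodeClauses.eval inp s) ∧
      ∃ k ≤ 6, EdgeStep k s (nodeClauses.eval inp s) := by
  have ht : EdgeStep 0 s (s.set .tmp (s.reg .tag - s.reg .one)) :=
    ⟨⟨fun v hv => by simp_all, fun f _ => by simp⟩, by simp, fun X hX _ =>
      hX.set _ ((Nat.sub_le _ _).trans (hX.1 _))⟩
  have he : Edges ns adj (s.set .tmp (s.reg .tag - s.reg .one)) :=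
    h.congr (by simp) fun f _ => by simp
  generalize htag : s.reg .tag = t at hN
  generalize hlhs : s.reg .lhs = l at hN
  generalize hrhs : s.reg .rhs = r at hN
  cases hN with
  | bit b hl =>
    refine ⟨adj, fun x => List.Subset.refl _, ⟨by simp, by simp⟩, ?_, 0, by omega, ?_⟩
    · simpa [nodeClauses, Code.eval, htag] using h
    · simp only [nodeClauses, Code.eval, htag, if_true]
      exact ⟨⟨fun _ _ => rfl, fun _ _ => rfl⟩, rfl, fun _ h _ => h⟩
  | conj hl hr =>
    have hev : nodeClauses.eval inp s = conjClauses.eval inp (s.set .tmp 0) := by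
      simp [nodeClauses, Code.eval, htag, hone]
    simp only [htag, hone] at ht he
    obtain ⟨adj', m, c1, c2, c3, e, st⟩ := he.eval_addClauses (inp := inp) (c := conjClauses)
      (by decide) (by simpa using hone)
      (by simp only [St.reg_set, reduceCtorEq, if_false, hlhs]
          exact ⟨_, _, _, hcur, hcur, hl, fun Γ h _ => .conjE₁ _ _ _ h⟩)
      (by simp only [St.reg_set, reduceCtorEq, if_false, hrhs]
          exact ⟨_, _, _, hcur, hcur, hr, fun Γ h _ => .conjE₂ _ _ _ h⟩)
      (by simp only [St.reg_set, reduceCtorEq, if_false, hlhs, hrhs]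
          exact ⟨_, _, _, hl, hr, hcur, fun Γ h h' => .conjI _ _ _ h h'⟩) rfl
    simp only [St.reg_set, reduceCtorEq, if_false, hlhs, hrhs] at c1 c2 c3
    rw [hev]
    exact ⟨adj', m, ⟨fun _ => ⟨c1, c2, c3⟩, by simp⟩, e, 0 + 6, by omega, ht.trans st⟩
  | imp hl hr =>
    have hev : nodeClauses.eval inp s = impClauses.eval inp (s.set .tmp 1) := by
      simp [nodeClauses, Code.eval, htag, hone]
    simp only [htag, hone] at ht he
    obtain ⟨adj', m, c1, c2, c3, e, st⟩ := he.eval_addClauses (inp := inp) (c := impClauses)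
      (by decide) (by simpa using hone)
      (by simp only [St.reg_set, reduceCtorEq, if_false, hrhs]
          exact ⟨_, _, _, hr, hr, hcur, fun Γ h _ => .impI _ _ _ h⟩)
      (by simp only [St.reg_set, reduceCtorEq, if_false, hlhs, hrhs]
          exact ⟨_, _, _, hl, hcur, hr, fun Γ h h' => .impE _ _ _ h h'⟩)
      (by simp only [St.reg_set, reduceCtorEq, if_false, hone, hrhs]
          exact ⟨_, _, _, hbot, hcur, hr, fun Γ h h' => .botE _ _ _ rfl h h'⟩) rfl
    simp only [St.reg_set, reduceCtorEq, if_false, hlhs, hrhs, hone] at c1 c2 c3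
    rw [hev]
    exact ⟨adj', m, ⟨by simp, fun _ => ⟨c1, c2, c3⟩⟩, e, 0 + 6, by omega, ht.trans st⟩


@[simp] theorem St.set_set (s : St) (d : Var) (v w : ℕ) : (s.set d v).set d w = s.set d w := by
  simp only [St.set, St.mk.injEq, and_true]
  funext e
  split <;> rfl

theorem Heap.eval_computeKey {inp : List ℕ} {M : ℕ} {ns : List Infon} {adj : ℕ → List (ℕ × ℕ)}
    {s : St} (h : Heap M ns adj s) (hl : s.reg .lhs < ns.length) :
    computeKey.eval inp s = s.set .key (tableKey M (s.reg .tag) (s.reg .lhs) (s.reg .rhs)) := by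
  simp only [computeKey, Code.eval, St.reg_set, reduceCtorEq, if_true, if_false, St.set_set,
    h.rows _ hl, tableKey]
  congr 1
  ring

/-- The table is complete: a compound infon with parts in the list is itself in the list only if
its table entry is not `0`. -/
theorem Heap.not_mem {M : ℕ} {ns : List Infon} {adj : ℕ → List (ℕ × ℕ)} {s : St}
    (h : Heap M ns adj s) {t l r : ℕ} {φ : Infon} (hN : Node ns t l r φ)
    (h0 : s.fld .table (tableKey M t l r) = 0) : φ ∉ ns := by
  intro hmem
  obtain ⟨n, hn⟩ := List.mem_iff_getElem?.1 hmem
  have h3 : 3 ≤ n := by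
    by_contra hlt
    have ht := h.top
    have hb := h.bot
    have hv := h.var
    obtain rfl | rfl | rfl : n = 0 ∨ n = 1 ∨ n = 2 := by omega
    all_goals cases hN <;> simp_all
  obtain ⟨t', l', r', hN', htab, -⟩ := h.node n φ h3 hn
  obtain ⟨rfl, rfl, rfl⟩ := hN.unique h.nodup hN'
  omega

/-- If the table has no entry for a compound infon, then the infon is appended to the list. -/
theorem Heap.eval_allocate {inp : List ℕ} {M : ℕ} {ns : List Infon} {adj : ℕ → List (ℕ × ℕ)}
    {s : St} (h : Heap M ns adj s) {φ : Infon} {X : ℕ}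
    (hN : Node ns (s.reg .tag) (s.reg .lhs) (s.reg .rhs) φ)
    (hkey : s.reg .key = tableKey M (s.reg .tag) (s.reg .lhs) (s.reg .rhs))
    (h0 : s.fld .table (s.reg .key) = 0) (hM : ns.length < M) (hX : s.Bdd X)
    (hMX : 4 * M * M ≤ X) :
    ∃ adj', Heap M (ns ++ [φ]) adj' ((allocate ;; nodeClauses).eval inp s) ∧
      ((allocate ;; nodeClauses).eval inp s).reg .cur = ns.length ∧
      AgreeOff [.cur, .cnt, .ecnt, .row, .key, .tmp] [.table, .row, .first, .other, .target, .next]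
        s ((allocate ;; nodeClauses).eval inp s) ∧
      ((allocate ;; nodeClauses).eval inp s).Bdd X := by
  have hpre : ns <+: ns ++ [φ] := List.prefix_append _ _
  have hlast : (ns ++ [φ])[ns.length]? = some φ := by simp
  have h3 := h.three_le
  have hnot : φ ∉ ns := h.not_mem hN (hkey ▸ h0)
  have hr : s.reg .rhs < M := by
    rcases hN.right_lt with h' | h' <;> omega
  have hMM : ns.length * M + M ≤ M * M := by
    rw [← Nat.succ_mul]
    exact Nat.mul_le_mul_right _ hM
  have hMX' : 4 * (M * M) ≤ X := by rwa [← mul_assoc]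
  have hMM' : 4 * M ≤ M * M := Nat.mul_le_mul_right _ (by omega)
  obtain ⟨s₁, hs₁⟩ : ∃ s₁, s₁ = allocate.eval inp s := ⟨_, rfl⟩
  have hev : (allocate ;; nodeClauses).eval inp s = nodeClauses.eval inp s₁ := by
    rw [hs₁, Code.eval]
  simp only [allocate, Code.eval] at hs₁
  have hb₁ : s₁.Bdd X := by
    rw [hs₁]
    refine St.Bdd.set (St.Bdd.set (St.Bdd.put (St.Bdd.put (hX.set _ ?_) _ _ ?_) _ _ ?_) _ ?_) _ ?_
      <;> simp [h.cnt, h.row, h.size, h.one] <;> omega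
  have a₁ : AgreeOff [.cur, .cnt, .ecnt, .row, .key, .tmp]
      [.table, .row, .first, .other, .target, .next] s s₁ := by
    refine ⟨fun v hv => ?_, fun f hf => ?_⟩
    · simp only [List.mem_cons, List.not_mem_nil, or_false, not_or] at hv
      simp [hs₁, hv]
    · simp only [List.mem_cons, List.not_mem_nil, or_false, not_or] at hf
      funext i
      simp [hs₁, hf]
  have hcur : s₁.reg .cur = ns.length := by simp [hs₁, h.cnt]
  have e₁ : Edges (ns ++ [φ]) adj s₁ := by
    refine (h.edges.mono hpre).congr (by simp [hs₁]) fun f hf => ?_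
    funext i
    simp only [List.mem_cons, List.not_mem_nil, or_false] at hf
    rcases hf with rfl | rfl | rfl | rfl <;> simp [hs₁]
  have htag := a₁.reg .tag (by decide)
  have hlhs := a₁.reg .lhs (by decide)
  have hrhs := a₁.reg .rhs (by decide)
  obtain ⟨adj', hm, hcl, e₂, k, hk, st⟩ := e₁.eval_nodeClauses (inp := inp) (φ := φ)
    ((a₁.reg .one (by decide)).trans h.one) (getElem?_of_prefix hpre h.bot)
    (by rw [htag, hlhs, hrhs]; exact hN.mono hpre) (by rw [hcur, hlast])
  rw [hev]
  rw [hcur, htag, hlhs, hrhs] at hcl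
  set s₂ := nodeClauses.eval inp s₁
  have a₂ := st.toAgreeOff.mono (V' := [.cur, .cnt, .ecnt, .row, .key, .tmp])
    (A' := [.table, .row, .first, .other, .target, .next])
    (by simp) (by simp)
  have hecnt : s₂.reg .ecnt ≤ 6 * (ns.length + 1) := by
    have h₁ := st.ecnt
    have h₂ : s₁.reg .ecnt = s.reg .ecnt := by simp [hs₁]
    have h₃ := h.ecnt_le
    omega
  have htable : ∀ i, s₂.fld .table i = if i = s.reg .key then ns.length else s.fld .table i := by
    intro i
    rw [st.fld .table (by decide)]
    simp [hs₁, h.cnt]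
  refine ⟨adj', ?_, (st.reg .cur (by decide)).trans hcur, a₁.trans a₂, st.bdd X hb₁ ?_⟩
  · constructor
    case one => exact ((a₁.trans a₂).reg .one (by decide)).trans h.one
    case size => exact ((a₁.trans a₂).reg .size (by decide)).trans h.size
    case cnt =>
      rw [st.reg .cnt (by decide)]
      simp [hs₁, h.cnt, h.one]
    case row =>
      rw [st.reg .row (by decide)]
      simp [hs₁, h.row, h.size, Nat.succ_mul]
    case rows =>
      intro i hi
      rw [st.fld .row (by decide)]
      by_cases hin : i = ns.length
      · simp [hs₁, h.row, h.cnt, hin]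
      · have := h.rows i (by simp at hi; omega)
        simp [hs₁, h.cnt, hin, this]
    case edges => exact e₂
    case ecnt_le => simpa using hecnt
    case nodup => simpa [List.nodup_append, h.nodup] using fun a ha (e : a = φ) => hnot (e ▸ ha)
    case top => exact getElem?_of_prefix hpre h.top
    case bot => exact getElem?_of_prefix hpre h.bot
    case var => exact getElem?_of_prefix hpre h.var
    case table =>
      intro t l r ht hrM hne
      rw [htable, hkey] at hne ⊢
      split at hne
      · next heq =>
        obtain ⟨rfl, rfl, rfl⟩ := tableKey_inj ht (hN.tag_lt.trans (by decide)) hrM hr heq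
        rw [if_pos rfl]
        exact ⟨φ, hN.mono hpre, hlast⟩
      · next hne' =>
        rw [if_neg hne']
        obtain ⟨ψ, h₁, h₂⟩ := h.table t l r ht hrM hne
        exact ⟨ψ, h₁.mono hpre, getElem?_of_prefix hpre h₂⟩
    case node =>
      intro n ψ hn hψ
      by_cases hlt : n < ns.length
      · rw [List.getElem?_append_left hlt] at hψ
        obtain ⟨t, l, r, h₁, h₂, h₃⟩ := h.node n ψ hn hψ
        refine ⟨t, l, r, h₁.mono hpre, ?_, h₃.mono hm⟩
        -- the new entry overwrites a `0`, and entries of earlier compound infons are not `0`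
        rw [htable, if_neg, h₂]
        intro heq
        rw [heq, h0] at h₂
        omega
      · obtain rfl : n = ns.length := by
          have := lt_of_getElem?_eq_some hψ
          simp at this
          omega
        rw [hlast, Option.some_inj] at hψ
        subst hψ
        exact ⟨_, _, _, hN.mono hpre, by rw [htable, if_pos hkey.symm], hcl⟩
  · rw [← st.ecnt]
    omega

/-- After hash-consing, `cur` is the number of the given compound infon, and the list has grown by
at most one infon. -/
theorem Heap.eval_hashCons {inp : List ℕ} {M : ℕ} {ns : List Infon} {adj : ℕ → List (ℕ × ℕ)}
    {s : St} (h : Heap M ns adj s) {φ : Infon} {X : ℕ}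
    (hN : Node ns (s.reg .tag) (s.reg .lhs) (s.reg .rhs) φ) (hM : ns.length < M) (hX : s.Bdd X)
    (hMX : 4 * M * M ≤ X) :
    ∃ ns' adj', ns <+: ns' ∧ ns'.length ≤ ns.length + 1 ∧
      Heap M ns' adj' (hashCons.eval inp s) ∧
      ns'[(hashCons.eval inp s).reg .cur]? = some φ ∧
      AgreeOff [.cur, .cnt, .ecnt, .row, .key, .tmp] [.table, .row, .first, .other, .target, .next]
        s (hashCons.eval inp s) ∧ (hashCons.eval inp s).Bdd X := by
  have h3 := h.three_le
  have hr : s.reg .rhs < M := by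
    rcases hN.right_lt with h' | h' <;> omega
  have ht := hN.tag_lt.trans (show 3 < 4 by decide)
  have hk := tableKey_lt ht (hN.left_lt.trans hM) hr
  obtain ⟨K, hK⟩ : ∃ K, K = tableKey M (s.reg .tag) (s.reg .lhs) (s.reg .rhs) := ⟨_, rfl⟩
  have hev : hashCons.eval inp s =
      (Code.ifZero .cur (allocate ;; nodeClauses) .skip).eval inp
        ((s.set .key K).set .cur (s.fld .table K)) := by
    simp only [hashCons, Code.eval, h.eval_computeKey hN.left_lt, hK]
    simp
  rw [← hK] at hk
  have hb : ((s.set .key K).set .cur (s.fld .table K)).Bdd X :=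
    (hX.set _ (by omega)).set _ (hX.2 _ _)
  have hag : AgreeOff [.cur, .cnt, .ecnt, .row, .key, .tmp]
      [.table, .row, .first, .other, .target, .next] s
        ((s.set .key K).set .cur (s.fld .table K)) := by
    refine ⟨fun v hv => ?_, fun f _ => by simp⟩
    simp only [List.mem_cons, List.not_mem_nil, or_false, not_or] at hv
    simp [hv]
  have hh : Heap M ns adj ((s.set .key K).set .cur (s.fld .table K)) := by
    refine h.congr (fun v hv => ?_) (fun f _ => by simp)
    simp only [List.mem_cons, List.not_mem_nil, or_false] at hv
    rcases hv with rfl | rfl | rfl | rfl | rfl <;> simp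
  rw [hev, Code.eval]
  by_cases h0 : s.fld .table K = 0
  · rw [if_pos (by simpa using h0)]
    obtain ⟨adj', h₁, h₂, h₃, h₄⟩ := hh.eval_allocate (inp := inp) (φ := φ) (by simpa using hN)
      (by simpa using hK) (by simpa using h0) hM hb hMX
    exact ⟨ns ++ [φ], adj', List.prefix_append _ _, by simp, h₁, by rw [h₂]; simp, hag.trans h₃, h₄⟩
  · rw [if_neg (by simpa using h0), Code.eval]
    refine ⟨ns, adj, List.prefix_rfl, by omega, hh, ?_, hag, hb⟩
    rw [hK] at h0
    obtain ⟨ψ, h₁, h₂⟩ := h.table _ _ _ ht hr h0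
    rw [h₁.det hN, ← hK] at h₂
    simpa using h₂

/-! ### The queue of derived infons -/

/-- The queue array holds the list `q` of distinct numbers below `N`, and these are the marked
numbers. -/
structure Queue (q : List ℕ) (N : ℕ) (s : St) : Prop where
  tail : s.reg .tail = q.length
  entry : ∀ k x, q[k]? = some x → s.fld .queue k = x
  mark : ∀ x, s.fld .mark x ≠ 0 ↔ x ∈ q
  nodup : q.Nodup
  lt : ∀ x ∈ q, x < N

theorem Queue.congr {q : List ℕ} {N N' : ℕ} {s s' : St} (h : Queue q N s) (hN : N ≤ N')
    (htail : s'.reg .tail = s.reg .tail) (hfld : ∀ f ∈ [Arr.queue, .mark], s'.fld f = s.fld f) :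
    Queue q N' s' := by
  have h₁ := hfld .queue (by decide)
  have h₂ := hfld .mark (by decide)
  exact ⟨htail.trans h.tail, h₁ ▸ h.entry, h₂ ▸ h.mark, h.nodup,
    fun x hx => (h.lt x hx).trans_le hN⟩

theorem Queue.length_le {q : List ℕ} {N : ℕ} {s : St} (h : Queue q N s) : q.length ≤ N := by
  rw [← List.toFinset_card_of_nodup h.nodup, ← Finset.card_range N]
  exact Finset.card_le_card fun x hx => Finset.mem_range.2 (h.lt x (List.mem_toFinset.1 hx))

/-- Put `a` into the queue unless it has been there before. -/
def push (a : Var) : Code :=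
  .load .tmp .mark a ;;
    .ifZero .tmp (.store .mark a .one ;; .store .queue .tail a ;; .add .tail .tail .one) .skip

theorem Queue.eval_push {inp : List ℕ} {q : List ℕ} {N X : ℕ} {s : St} (h : Queue q N s)
    (hone : s.reg .one = 1) {a : Var} (ha : a ≠ .tmp) (haN : s.reg a < N) (hX : s.Bdd X)
    (hNX : N ≤ X) :
    ∃ q', q <+: q' ∧ (∀ x, x ∈ q' ↔ x ∈ q ∨ x = s.reg a) ∧ Queue q' N ((push a).eval inp s) ∧
      AgreeOff [.tail, .tmp] [.queue, .mark] s ((push a).eval inp s) ∧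
      ((push a).eval inp s).Bdd X := by
  by_cases h0 : s.fld .mark (s.reg a) = 0
  · have hev : (push a).eval inp s = (((s.set .tmp 0).put .mark (s.reg a) 1).put .queue
        (s.reg .tail) (s.reg a)).set .tail (s.reg .tail + 1) := by
      simp [push, Code.eval, h0, ha, hone]
    have hnot : s.reg a ∉ q := fun hmem => (h.mark _).2 hmem h0
    have hq : Queue (q ++ [s.reg a]) N ((push a).eval inp s) := by
      rw [hev]
      constructor
      · simp [h.tail]
      · intro k x hk
        by_cases hlt : k < q.length
        · rw [List.getElem?_append_left hlt] at hk
          simpa [h.tail, hlt.ne] using h.entry k x hk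
        · obtain rfl : k = q.length := by
            have := lt_of_getElem?_eq_some hk
            simp at this
            omega
          simpa [h.tail] using hk
      · intro x
        by_cases hx : x = s.reg a
        · simp [hx]
        · simpa [hx] using h.mark x
      · simpa [List.nodup_append, h.nodup] using fun x hx (e : x = s.reg a) => hnot (e ▸ hx)
      · intro x hx
        rcases List.mem_append.1 hx with hx | hx
        · exact h.lt x hx
        · rw [List.mem_singleton.1 hx]
          exact haN
    refine ⟨q ++ [s.reg a], List.prefix_append _ _, by simp, hq, ⟨fun v hv => ?_, fun f hf => ?_⟩,
      ?_⟩
    · simp only [List.mem_cons, List.not_mem_nil, or_false, not_or] at hv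
      simp [hev, hv]
    · simp only [List.mem_cons, List.not_mem_nil, or_false, not_or] at hf
      funext i
      simp [hev, hf]
    · have hlen := hq.length_le
      rw [hev]
      refine St.Bdd.set (St.Bdd.put (St.Bdd.put (hX.set _ (by omega)) _ _ (by omega)) _ _
        (hX.1 _)) _ ?_
      simp at hlen
      rw [h.tail]
      omega
  · have hev : (push a).eval inp s = s.set .tmp (s.fld .mark (s.reg a)) := by
      simp [push, Code.eval, h0]
    rw [hev]
    refine ⟨q, List.prefix_rfl, fun x => ?_, h.congr le_rfl (by simp) (by simp), ⟨fun v hv => ?_,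
      fun f _ => by simp⟩, hX.set _ (hX.2 _ _)⟩
    · have := (h.mark _).1 h0
      constructor
      · exact .inl
      · rintro (h | rfl) <;> assumption
    · simp only [List.mem_cons, List.not_mem_nil, or_false, not_or] at hv
      simp [hv]

/-! ### Reading the input -/

/-- The list of infons and the queue are represented, and the numbers are bounded. -/
structure Core (M X : ℕ) (ns : List Infon) (adj : ℕ → List (ℕ × ℕ)) (q : List ℕ) (s : St) :
    Prop where
  heap : Heap M ns adj s
  queue : Queue q ns.length s
  bdd : s.Bdd X

theorem Core.set {M X : ℕ} {ns : List Infon} {adj : ℕ → List (ℕ × ℕ)} {q : List ℕ} {s : St}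
    (h : Core M X ns adj q s) {d : Var} {v : ℕ}
    (hd : d ∉ [Var.one, .size, .cnt, .row, .ecnt, .tail]) (hv : v ≤ X) :
    Core M X ns adj q (s.set d v) := by
  simp only [List.mem_cons, List.not_mem_nil, or_false, not_or] at hd
  refine ⟨h.heap.congr (fun e he => ?_) fun _ _ => rfl, h.queue.congr le_rfl ?_ fun _ _ => rfl,
    h.bdd.set _ hv⟩
  · simp only [List.mem_cons, List.not_mem_nil, or_false] at he
    rw [St.reg_set, if_neg]
    rintro rfl
    simp [hd] at he
  · simp [Ne.symm hd.2.2.2.2.2]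

theorem Core.put {M X : ℕ} {ns : List Infon} {adj : ℕ → List (ℕ × ℕ)} {q : List ℕ} {s : St}
    (h : Core M X ns adj q s) {f : Arr} {i v : ℕ} (hf : f ∈ [Arr.stackTag, .stackArg])
    (hv : v ≤ X) : Core M X ns adj q (s.put f i v) := by
  simp only [List.mem_cons, List.not_mem_nil, or_false] at hf
  refine ⟨h.heap.congr (fun _ _ => rfl) fun g hg => ?_, h.queue.congr le_rfl rfl fun g hg => ?_,
    h.bdd.put _ _ hv⟩
  all_goals
    simp only [List.mem_cons, List.not_mem_nil, or_false] at hg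
    funext j
    rw [St.fld_put, if_neg]
    rintro ⟨rfl, -⟩
    rcases hf with rfl | rfl <;> simp at hg

/-- The number by which the stack arrays represent a connective. It is the tag of the compound
infons with this connective, too. -/
def Conn.tag : Conn → ℕ
  | .and => 1
  | .imp => 2

/-- The cell with index `i` of the stack arrays represents a frame. -/
def Frame.Rep (ns : List Infon) (s : St) (i : ℕ) : Frame → Prop
  | .paren => s.fld .stackTag i = 3
  | .left o φ => s.fld .stackTag i = o.tag ∧ ns[s.fld .stackArg i]? = some φ

/-- The stack arrays represent a stack. Its bottom is marked by the tag `0` in cell `0`. -/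
def StackRep (ns : List Infon) (s : St) : List Frame → Prop
  | [] => s.fld .stackTag 0 = 0
  | f :: st => f.Rep ns s (st.length + 1) ∧ StackRep ns s st

theorem StackRep.congr {ns ns' : List Infon} (hns : ns <+: ns') {s s' : St} {st : List Frame}
    (hs : ∀ i ≤ st.length, s'.fld .stackTag i = s.fld .stackTag i ∧
      s'.fld .stackArg i = s.fld .stackArg i) (h : StackRep ns s st) : StackRep ns' s' st := by
  induction st with
  | nil => exact (hs 0 le_rfl).1.trans h
  | cons f st ih =>
    have htop := hs (st.length + 1) le_rfl
    refine ⟨?_, ih (fun i hi => hs i (by simp; omega)) h.2⟩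
    cases f with
    | paren => exact htop.1.trans h.1
    | left o φ => exact ⟨htop.1.trans h.1.1, htop.2 ▸ getElem?_of_prefix hns h.1.2⟩

/-- The tag of the top cell of a stack. -/
def topTag : List Frame → ℕ
  | [] => 0
  | .paren :: _ => 3
  | .left o _ :: _ => o.tag

theorem StackRep.topTag {ns : List Infon} {s : St} {st : List Frame} (h : StackRep ns s st) :
    s.fld .stackTag st.length = topTag st := by
  rcases st with _ | ⟨_ | _, st⟩
  exacts [h, h.1, h.1.1]

/-- The number that represents the kind of focus. -/
def Focus.code : Focus → ℕ
  | .start => 0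
  | .done _ => 1
  | .word _ => 2

/-- The queue holds the numbers of `⊤` and of the hypotheses. -/
structure Hypotheses (ns : List Infon) (q : List ℕ) (Γ : List Infon) : Prop where
  top : 0 ∈ q
  mem : ∀ γ ∈ Γ, ∃ x ∈ q, ns[x]? = some γ
  sub : ∀ x ∈ q, ∃ φ, ns[x]? = some φ ∧ (φ = .top ∨ φ ∈ Γ)

theorem Hypotheses.mono {ns ns' : List Infon} (hns : ns <+: ns') {q : List ℕ} {Γ : List Infon}
    (h : Hypotheses ns q Γ) : Hypotheses ns' q Γ := by
  refine ⟨h.top, fun γ hγ => ?_, fun x hx => ?_⟩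
  · obtain ⟨x, hx, hn⟩ := h.mem γ hγ
    exact ⟨x, hx, getElem?_of_prefix hns hn⟩
  · obtain ⟨φ, hn, hφ⟩ := h.sub x hx
    exact ⟨φ, getElem?_of_prefix hns hn, hφ⟩

/-- The state represents a state of the parser. -/
structure ParserRep (ns : List Infon) (q : List ℕ) (σ : Parser) (s : St) : Prop where
  depth : s.reg .depth = σ.stack.length
  stack : StackRep ns s σ.stack
  seen : s.reg .seen = σ.seen.toNat
  focus : s.reg .focus = σ.focus.code
  cur : ∀ φ, σ.focus.infon? = some φ → ns[s.reg .cur]? = some φ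
  hyps : Hypotheses ns q σ.hyps

/-- The branch for the symbols `⊤`, `⊥` and `x`, whose infons have the number `n`; the new focus
has the code `k`. -/
def readStart (n k : ℕ) : Code :=
  .ifZero .focus (.const .cur n ;; .const .focus k ;; .const .run 1) .skip

/-- The branch for the bit `b`. The truncated difference of `focus` and `1` is zero unless the focus
is an atom whose name may go on. -/
def readBit (b : ℕ) : Code :=
  .sub .tmp .focus .one ;;
    .ifZero .tmp .skip
      (.mov .lhs .cur ;; .const .rhs b ;; .const .tag 0 ;; hashCons ;; .const .run 1)

/-- The branch for an opening parenthesis. -/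
def readLpar : Code :=
  .ifZero .focus
    (.add .depth .depth .one ;; .const .tmp 3 ;; .store .stackTag .depth .tmp ;; .const .run 1)
    .skip

/-- The branch for a closing parenthesis. The top of the stack has to be a connective, that is, its
tag is neither `0` nor `3`. -/
def readRpar : Code :=
  .ifZero .focus .skip (.ifZero .top .skip (.const .tmp 3 ;; .sub .tmp .tmp .top ;;
    .ifZero .tmp .skip
      (.mov .tag .top ;; .load .lhs .stackArg .depth ;; .mov .rhs .cur ;;
        .sub .depth .depth .one ;; hashCons ;; .const .focus 1 ;; .const .run 1)))

/-- The branch for the connective with tag `t`. -/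
def readConn (t : ℕ) : Code :=
  .ifZero .focus .skip (.const .tmp 3 ;; .sub .tmp .tmp .top ;;
    .ifZero .tmp
      (.const .tmp t ;; .store .stackTag .depth .tmp ;; .store .stackArg .depth .cur ;;
        .const .focus 0 ;; .const .run 1)
      .skip)

/-- The branch for a comma. -/
def readComma : Code :=
  .ifZero .focus .skip (.ifZero .top
    (.ifZero .seen (push .cur ;; .const .focus 0 ;; .const .run 1) .skip) .skip)

/-- The branch for `⊢`. -/
def readTurnstile : Code :=
  .ifZero .focus (.ifZero .top (.ifZero .seen (.const .seen 1 ;; .const .run 1) .skip) .skip) .skip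

/-- The branch for the end of the input. -/
def readEnd : Code :=
  .ifZero .focus .skip (.ifZero .top (.ifZero .seen .skip (.const .ok 1)) .skip)

/-- The situation in which the branches of the reading loop are entered. -/
structure Ready (M X : ℕ) (ns : List Infon) (adj : ℕ → List (ℕ × ℕ)) (q : List ℕ) (σ : Parser)
    (s : St) : Prop extends Core M X ns adj q s where
  parser : ParserRep ns q σ s
  run : s.reg .run = 0
  ok : s.reg .ok = 0
  top : s.reg .top = topTag σ.stack
  depth_lt : σ.stack.length < X
  length_lt : ns.length < M
  le : 4 * M * M ≤ X

/-- The result of a branch of the reading loop, if the parser moves to `next`, and at most one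
infon is added to a list of length `N`. -/
def Outcome (M X N p : ℕ) (next : Option Parser) (s : St) : Prop :=
  s.reg .pos = p ∧ s.reg .ok = 0 ∧ ∃ ns adj q, Core M X ns adj q s ∧ ns.length ≤ N + 1 ∧
    match next with
    | none => s.reg .run = 0
    | some σ => s.reg .run = 1 ∧ ParserRep ns q σ s

section branches

variable {inp : List ℕ} {M X : ℕ} {ns : List Infon} {adj : ℕ → List (ℕ × ℕ)} {q : List ℕ}
  {σ : Parser} {s : St}

theorem Ready.reject (h : Ready M X ns adj q σ s) : Outcome M X ns.length (s.reg .pos) none s :=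
  ⟨rfl, h.ok, ns, adj, q, h.toCore, by omega, h.run⟩

theorem Ready.three_le (h : Ready M X ns adj q σ s) : 3 ≤ X := by
  have h₁ := h.heap.three_le
  have h₂ := h.length_lt
  have h₃ := h.le
  nlinarith

theorem Ready.reject_tmp (h : Ready M X ns adj q σ s) {v : ℕ} (hv : v ≤ 3) :
    Outcome M X ns.length (s.reg .pos) none (s.set .tmp v) :=
  ⟨by simp, by simpa using h.ok, ns, adj, q, h.toCore.set (by decide) (hv.trans h.three_le),
    by omega, by simpa using h.run⟩

theorem Ready.eval_readStart (h : Ready M X ns adj q σ s) {n : ℕ} {f : Focus} {φ : Infon}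
    (hf : f.infon? = some φ) (hn : ns[n]? = some φ) :
    Outcome M X ns.length (s.reg .pos) (σ.start f) ((readStart n f.code).eval inp s) := by
  have h3 := h.three_le
  have hfocus := h.parser.focus
  have hnX : n ≤ X := by
    have h₁ := lt_of_getElem?_eq_some hn
    have h₂ := h.length_lt
    have h₃ := h.le
    nlinarith
  have hfc : f.code ≤ 3 := by cases f <;> simp [Focus.code]
  obtain ⟨hyps, seen, stack, focus⟩ := σ
  cases focus with
  | start =>
    have hev : (readStart n f.code).eval inp s =
        ((s.set .cur n).set .focus f.code).set .run 1 := by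
      simp [readStart, Code.eval, hfocus, Focus.code]
    rw [hev]
    refine ⟨by simp, by simpa using h.ok, ns, adj, q, ((h.toCore.set (by decide) hnX).set
      (by decide) (by omega)).set (by decide) (by omega), by omega, by simp, ?_⟩
    refine ⟨by simpa using h.parser.depth, h.parser.stack.congr List.prefix_rfl (by simp),
      by simpa using h.parser.seen, by simp, fun ψ hψ => ?_, h.parser.hyps⟩
    obtain rfl : φ = ψ := Option.some_inj.1 (hf.symm.trans hψ)
    simpa using hn
  | done ψ => simpa [readStart, Code.eval, hfocus, Focus.code, Parser.start] using h.reject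
  | word a => simpa [readStart, Code.eval, hfocus, Focus.code, Parser.start] using h.reject

theorem Ready.eval_readLpar (h : Ready M X ns adj q σ s) :
    Outcome M X ns.length (s.reg .pos) (σ.next .lpar) (readLpar.eval inp s) := by
  have h3 := h.three_le
  have hfocus := h.parser.focus
  have hdepth := h.parser.depth
  have hlt := h.depth_lt
  obtain ⟨hyps, seen, stack, focus⟩ := σ
  cases focus with
  | start =>
    have hev : readLpar.eval inp s = (((s.set .depth (stack.length + 1)).set .tmp 3).put .stackTag
        (stack.length + 1) 3).set .run 1 := by
      simp [readLpar, Code.eval, hfocus, Focus.code, hdepth, h.heap.one]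
    rw [hev]
    refine ⟨by simp, by simpa using h.ok, ns, adj, q, (((h.toCore.set (by decide) hlt).set
      (by decide) h3).put (by decide) h3).set (by decide) (by omega), by omega, by simp, ?_⟩
    refine ⟨by simp, ⟨by simp [Frame.Rep], h.parser.stack.congr List.prefix_rfl fun i hi => ?_⟩,
      by simpa using h.parser.seen, by simpa using hfocus, by simp [Focus.infon?], h.parser.hyps⟩
    simp only at hi
    simp
    omega
  | done ψ => simpa [readLpar, Code.eval, hfocus, Focus.code, Parser.next] using h.reject
  | word a => simpa [readLpar, Code.eval, hfocus, Focus.code, Parser.next] using h.reject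

theorem Ready.eval_readTurnstile (h : Ready M X ns adj q σ s) :
    Outcome M X ns.length (s.reg .pos) (σ.next .turnstile) (readTurnstile.eval inp s) := by
  have h3 := h.three_le
  have hfocus := h.parser.focus
  have hseen := h.parser.seen
  have htop := h.top
  obtain ⟨hyps, seen, stack, focus⟩ := σ
  rcases focus with _ | ψ | a
  · rcases stack with _ | ⟨_ | ⟨_ | _, _⟩, stack⟩
    · cases seen
      · have hev : readTurnstile.eval inp s = (s.set .seen 1).set .run 1 := by
          simp [readTurnstile, Code.eval, hfocus, Focus.code, hseen, htop, topTag]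
        rw [hev]
        refine ⟨by simp, by simpa using h.ok, ns, adj, q, (h.toCore.set (by decide)
          (by omega)).set (by decide) (by omega), by omega, by simp, ?_⟩
        exact ⟨by simpa using h.parser.depth, h.parser.stack.congr List.prefix_rfl (by simp),
          by simp, by simpa using hfocus, by simp [Focus.infon?], h.parser.hyps⟩
      · simpa [readTurnstile, Code.eval, hfocus, Focus.code, Parser.next, hseen, htop, topTag]
          using h.reject
    all_goals
      simpa [readTurnstile, Code.eval, hfocus, Focus.code, Parser.next, hseen, htop, topTag,
        Conn.tag] using h.reject
  all_goals
    simpa [readTurnstile, Code.eval, hfocus, Focus.code, Parser.next] using h.reject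

theorem Ready.eval_readComma (h : Ready M X ns adj q σ s) :
    Outcome M X ns.length (s.reg .pos) (σ.next .comma) (readComma.eval inp s) := by
  have h3 := h.three_le
  have hfocus := h.parser.focus
  have hseen := h.parser.seen
  have htop := h.top
  have hMX := h.le
  have hlen := h.length_lt
  obtain ⟨hyps, seen, stack, focus⟩ := σ
  simp only at hseen hfocus htop
  cases hφ : focus.infon? with
  | none =>
    cases focus <;> simp [Focus.infon?] at hφ
    simpa [readComma, Code.eval, hfocus, Focus.code, Parser.next, Focus.infon?] using h.reject
  | some φ =>
    have hf0 : s.reg .focus ≠ 0 := by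
      cases focus <;> simp_all [Focus.infon?, Focus.code]
    rcases stack with _ | ⟨_ | ⟨_ | _, _⟩, stack⟩
    · cases seen
      · have hev : readComma.eval inp s =
            (((push .cur).eval inp s).set .focus 0).set .run 1 := by
          simp [readComma, Code.eval, hf0, hseen, htop, topTag]
        have hcur := h.parser.cur φ hφ
        obtain ⟨q', -, hmem, hq', hag, hb⟩ := h.queue.eval_push (inp := inp) h.heap.one (a := .cur)
          (by decide) (lt_of_getElem?_eq_some hcur) h.bdd (by nlinarith)
        have hheap : Heap M ns adj ((push .cur).eval inp s) := by
          refine h.heap.congr (fun v hv => hag.reg v ?_) (fun f hf => hag.fld f ?_)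
          · revert v; decide
          · revert f; decide
        have hcore : Core M X ns adj q' ((push .cur).eval inp s) := ⟨hheap, hq', hb⟩
        have e : (⟨hyps, false, [], focus⟩ : Parser).next .comma =
            some ⟨hyps ++ [φ], false, [], .start⟩ := by
          simp [Parser.next, hφ]
        rw [hev, e]
        have hfld := hag.fld
        refine ⟨?_, ?_, ns, adj, q', (hcore.set (by decide)
          (by omega)).set (by decide) (by omega), by omega, by simp, ?_⟩
        · simp [hag.reg]
        · simp [hag.reg, h.ok]
        refine ⟨?_, h.parser.stack.congr List.prefix_rfl (by simp [hfld]), ?_, by simp [Focus.code],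
          by simp [Focus.infon?], ?_, fun γ hγ => ?_, fun x hx => ?_⟩
        · simpa [hag.reg] using h.parser.depth
        · simpa [hag.reg] using hseen
        · exact (hmem 0).2 (.inl h.parser.hyps.top)
        · rcases List.mem_append.1 hγ with hγ | hγ
          · obtain ⟨x, hx, hn⟩ := h.parser.hyps.mem γ hγ
            exact ⟨x, (hmem x).2 (.inl hx), hn⟩
          · rw [List.mem_singleton.1 hγ]
            exact ⟨_, (hmem _).2 (.inr rfl), hcur⟩
        · rcases (hmem x).1 hx with hx | rfl
          · obtain ⟨ψ, hn, hψ⟩ := h.parser.hyps.sub x hx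
            exact ⟨ψ, hn, hψ.imp_right fun hψ => List.mem_append_left _ hψ⟩
          · exact ⟨φ, hcur, .inr (by simp)⟩
      · simpa [readComma, Code.eval, hf0, Parser.next, hseen, htop, topTag, hφ]
          using h.reject
    all_goals
      simpa [readComma, Code.eval, hf0, Parser.next, hseen, htop, topTag, hφ, Conn.tag]
        using h.reject

theorem Ready.eval_readConn (h : Ready M X ns adj q σ s) (o : Conn) :
    Outcome M X ns.length (s.reg .pos) (σ.connective o) ((readConn o.tag).eval inp s) := by
  have h3 := h.three_le
  have hfocus := h.parser.focus
  have htop := h.top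
  have hdepth := h.parser.depth
  have hot : o.tag ≤ 3 := by cases o <;> decide
  obtain ⟨hyps, seen, stack, focus⟩ := σ
  simp only at hfocus htop hdepth
  cases hφ : focus.infon? with
  | none =>
    cases focus <;> simp [Focus.infon?] at hφ
    simpa [readConn, Code.eval, hfocus, Focus.code, Parser.connective, Focus.infon?] using h.reject
  | some φ =>
    have hf0 : s.reg .focus ≠ 0 := by
      cases focus <;> simp_all [Focus.infon?, Focus.code]
    rcases stack with _ | ⟨_ | ⟨_ | _, _⟩, stack⟩
    case cons.paren =>
      have hev : (readConn o.tag).eval inp s =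
          ((((s.set .tmp o.tag).put .stackTag (stack.length + 1) o.tag).put .stackArg
            (stack.length + 1) (s.reg .cur)).set .focus 0).set .run 1 := by
        simp [readConn, Code.eval, hf0, htop, topTag, hdepth]
      have hcur := h.parser.cur φ hφ
      have e : (⟨hyps, seen, .paren :: stack, focus⟩ : Parser).connective o =
          some ⟨hyps, seen, .left o φ :: stack, .start⟩ := by
        simp [Parser.connective, hφ]
      rw [hev, e]
      refine ⟨by simp, by simpa using h.ok, ns, adj, q, ((((h.toCore.set (by decide)
        (by omega)).put (by decide) (by omega)).put (by decide) (h.bdd.1 _)).set (by decide)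
        (by omega)).set (by decide) (by omega), by omega, by simp, ?_⟩
      refine ⟨by simpa using hdepth, ⟨⟨by simp, by simpa using hcur⟩, h.parser.stack.2.congr
        List.prefix_rfl fun i hi => ?_⟩,
        by simpa using h.parser.seen, by simp [Focus.code], by simp [Focus.infon?], h.parser.hyps⟩
      simp
      omega
    all_goals
      simpa [readConn, Code.eval, hf0, Parser.connective, htop, topTag, hφ, Conn.tag]
        using h.reject_tmp (by omega)

theorem Core.eval_hashCons (h : Core M X ns adj q s) {φ : Infon}
    (hN : Node ns (s.reg .tag) (s.reg .lhs) (s.reg .rhs) φ) (hM : ns.length < M)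
    (hMX : 4 * M * M ≤ X) :
    ∃ ns' adj', ns <+: ns' ∧ ns'.length ≤ ns.length + 1 ∧
      Core M X ns' adj' q (hashCons.eval inp s) ∧
      ns'[(hashCons.eval inp s).reg .cur]? = some φ ∧
      AgreeOff [.cur, .cnt, .ecnt, .row, .key, .tmp] [.table, .row, .first, .other, .target, .next]
        s (hashCons.eval inp s) := by
  obtain ⟨ns', adj', hpre, hlen, hheap, hcur, hag, hb⟩ :=
    h.heap.eval_hashCons (inp := inp) hN hM h.bdd hMX
  refine ⟨ns', adj', hpre, hlen, ⟨hheap, h.queue.congr hpre.length_le (hag.reg .tail (by decide))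
    fun f hf => hag.fld f ?_, hb⟩, hcur, hag⟩
  revert f
  decide

theorem Ready.eval_readBit (h : Ready M X ns adj q σ s) (b : Bool) :
    Outcome M X ns.length (s.reg .pos) (σ.bit b) ((readBit b.toNat).eval inp s) := by
  have h3 := h.three_le
  have hfocus := h.parser.focus
  have hone := h.heap.one
  obtain ⟨hyps, seen, stack, focus⟩ := σ
  rcases focus with _ | ψ | a
  · simpa [readBit, Code.eval, hfocus, Focus.code, Parser.bit, hone] using h.reject_tmp (by omega)
  · simpa [readBit, Code.eval, hfocus, Focus.code, Parser.bit, hone] using h.reject_tmp (by omega)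
  · obtain ⟨s₁, hs₁⟩ : ∃ s₁, s₁ = (((s.set .tmp 1).set .lhs (s.reg .cur)).set .rhs b.toNat).set
        .tag 0 := ⟨_, rfl⟩
    have hev : (readBit b.toNat).eval inp s = (hashCons.eval inp s₁).set .run 1 := by
      simp [readBit, Code.eval, hfocus, Focus.code, hone, hs₁]
    have hcur := h.parser.cur _ rfl
    have hb : b.toNat ≤ X := by cases b <;> simp; omega
    have hcore : Core M X ns adj q s₁ := by
      rw [hs₁]
      exact (((h.toCore.set (by decide) (by omega)).set (by decide) (h.bdd.1 _)).set (by decide)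
        hb).set (by decide) (by omega)
    obtain ⟨ns', adj', hpre, hlen, hcore', hcur', hag⟩ := hcore.eval_hashCons (inp := inp)
      (φ := .atom (a ++ [b])) (by simpa [hs₁] using Node.bit b hcur) h.length_lt h.le
    have hreg := hag.reg
    have hfld := hag.fld
    rw [hev]
    generalize hashCons.eval inp s₁ = s₂ at *
    refine ⟨?_, ?_, ns', adj', q, hcore'.set (by decide) (by omega), hlen, by simp, ?_⟩
    · simp [hreg, hs₁]
    · simp [hreg, hs₁, h.ok]
    refine ⟨?_, h.parser.stack.congr hpre ?_, ?_, ?_, ?_, h.parser.hyps.mono hpre⟩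
    · simpa [hreg, hs₁] using h.parser.depth
    · simp [hfld, hs₁]
    · simpa [hreg, hs₁] using h.parser.seen
    · simpa [hreg, hs₁, Focus.code] using hfocus
    · simpa [Focus.infon?] using hcur'

theorem Ready.eval_readRpar (h : Ready M X ns adj q σ s) :
    Outcome M X ns.length (s.reg .pos) (σ.next .rpar) (readRpar.eval inp s) := by
  have h3 := h.three_le
  have hfocus := h.parser.focus
  have htop := h.top
  have hdepth := h.parser.depth
  have hone := h.heap.one
  have hlt := h.depth_lt
  obtain ⟨hyps, seen, stack, focus⟩ := σ
  simp only at hfocus htop hdepth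
  cases hφ : focus.infon? with
  | none =>
    cases focus <;> simp [Focus.infon?] at hφ
    simpa [readRpar, Code.eval, hfocus, Focus.code, Parser.next, Focus.infon?] using h.reject
  | some ψ =>
    have hf0 : s.reg .focus ≠ 0 := by
      cases focus <;> simp_all [Focus.infon?, Focus.code]
    rcases stack with _ | ⟨_ | ⟨o, φ⟩, stack⟩
    case nil =>
      simpa [readRpar, Code.eval, hf0, Parser.next, htop, topTag, hφ] using h.reject
    case cons.paren =>
      simpa [readRpar, Code.eval, hf0, Parser.next, htop, topTag, hφ] using h.reject_tmp (by omega)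
    case cons.left =>
      have ho : o.tag ≠ 0 ∧ o.tag < 3 := by cases o <;> decide
      obtain ⟨s₁, hs₁⟩ : ∃ s₁, s₁ = ((((s.set .tmp (3 - o.tag)).set .tag o.tag).set .lhs
          (s.fld .stackArg (stack.length + 1))).set .rhs (s.reg .cur)).set .depth
            stack.length := ⟨_, rfl⟩
      have hev : readRpar.eval inp s =
          ((hashCons.eval inp s₁).set .focus 1).set .run 1 := by
        have : ¬ (3 - o.tag = 0) := by omega
        simp [readRpar, Code.eval, hf0, htop, topTag, hdepth, hone, hs₁, ho.1, this]
      have hcur := h.parser.cur _ hφ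
      have hcore : Core M X ns adj q s₁ := by
        rw [hs₁]
        simp only [List.length_cons] at hlt
        exact ((((h.toCore.set (by decide) (by omega)).set (by decide) (by omega)).set (by decide)
          (h.bdd.2 _ _)).set (by decide) (h.bdd.1 _)).set (by decide) (by omega)
      have hN : Node ns (s₁.reg .tag) (s₁.reg .lhs) (s₁.reg .rhs) (o.mk φ ψ) := by
        have hl := h.parser.stack.1.2
        cases o
        · simpa [hs₁, Conn.tag, Conn.mk] using Node.conj hl hcur
        · simpa [hs₁, Conn.tag, Conn.mk] using Node.imp hl hcur
      obtain ⟨ns', adj', hpre, hlen, hcore', hcur', hag⟩ := hcore.eval_hashCons (inp := inp)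
        hN h.length_lt h.le
      have hreg := hag.reg
      have hfld := hag.fld
      have e : (⟨hyps, seen, .left o φ :: stack, focus⟩ : Parser).next .rpar =
          some ⟨hyps, seen, stack, .done (o.mk φ ψ)⟩ := by
        simp [Parser.next, hφ]
      rw [hev, e]
      generalize hashCons.eval inp s₁ = s₂ at *
      refine ⟨?_, ?_, ns', adj', q, (hcore'.set (by decide) (by omega)).set (by decide) (by omega),
        hlen, by simp, ?_⟩
      · simp [hreg, hs₁]
      · simp [hreg, hs₁, h.ok]
      refine ⟨?_, h.parser.stack.2.congr hpre ?_, ?_, ?_, ?_, h.parser.hyps.mono hpre⟩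
      · simp [hreg, hs₁]
      · simp [hfld, hs₁]
      · simpa [hreg, hs₁] using h.parser.seen
      · simp [Focus.code]
      · simpa [Focus.infon?] using hcur'

/-- At the end of the input, the variable `ok` tells whether the input is a sequent. -/
theorem Ready.eval_readEnd (h : Ready M X ns adj q σ s) :
    ∃ v ≤ 1, readEnd.eval inp s = s.set .ok v ∧
      (v = 0 ∧ σ.result? = none ∨
        v = 1 ∧ ∃ φ, σ.result? = some (σ.hyps, φ) ∧ ns[s.reg .cur]? = some φ) := by
  have hfocus := h.parser.focus
  have hseen := h.parser.seen
  have htop := h.top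
  have hset : s.set .ok 0 = s := by
    have := h.ok
    obtain ⟨r, f⟩ := s
    simp only [St.set, St.mk.injEq, and_true]
    funext e
    split <;> simp_all
  obtain ⟨hyps, seen, stack, focus⟩ := σ
  simp only at hfocus htop hseen
  cases hφ : focus.infon? with
  | none =>
    cases focus <;> simp [Focus.infon?] at hφ
    refine ⟨0, by omega, ?_, .inl ⟨rfl, by simp [Parser.result?, Focus.infon?]⟩⟩
    simp [readEnd, Code.eval, hfocus, Focus.code, hset]
  | some φ =>
    have hf0 : s.reg .focus ≠ 0 := by
      cases focus <;> simp_all [Focus.infon?, Focus.code]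
    rcases stack with _ | ⟨_ | ⟨_ | _, _⟩, stack⟩
    case nil =>
      cases seen
      · refine ⟨0, by omega, ?_, .inl ⟨rfl, by simp [Parser.result?]⟩⟩
        simp [readEnd, Code.eval, hf0, htop, hseen, topTag, hset]
      · refine ⟨1, by omega, ?_, .inr ⟨rfl, φ, by simp [Parser.result?, hφ],
          h.parser.cur φ hφ⟩⟩
        simp [readEnd, Code.eval, hf0, htop, hseen, topTag]
    all_goals
      refine ⟨0, by omega, ?_, .inl ⟨rfl, by simp [Parser.result?]⟩⟩
      simp [readEnd, Code.eval, hf0, htop, topTag, hset, Conn.tag]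

end branches

/-- Run the entry of a list of programs with number `sym`. -/
def switch : List Code → Code
  | [] => .skip
  | c :: cs => .ifZero .sym c (.sub .sym .sym .one ;; switch cs)

theorem eval_switch {inp : List ℕ} {s : St} (hone : s.reg .one = 1) {cs : List Code} {c : Code}
    (hc : cs[s.reg .sym]? = some c) : (switch cs).eval inp s = c.eval inp (s.set .sym 0) := by
  generalize hk : s.reg .sym = k at hc
  induction cs generalizing s k with
  | nil => simp at hc
  | cons c' cs ih =>
    cases k with
    | zero =>
      obtain rfl : c' = c := by simpa using hc
      have : s.set .sym 0 = s := by
        obtain ⟨r, f⟩ := s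
        simp only [St.set, St.mk.injEq, and_true]
        funext e
        split <;> simp_all
      simp [switch, Code.eval, hk, this]
    | succ k =>
      have := ih (s := s.set .sym k) (by simpa using hone) k (by simp) (by simpa using hc)
      simpa [switch, Code.eval, hk, hone] using this

/-- The branches of the reading loop, in the order of the codes of the symbols. -/
def branches : List Code :=
  [readEnd, readStart 0 1, readStart 1 1, readStart 2 2, readBit 0, readBit 1, readLpar, readRpar,
    readConn 1, readConn 2, readComma, readTurnstile]

/-- The body of the reading loop. It is left with `run = 0` at the end of the input and at a
syntax error. -/
def readBody : Code :=
  .input .sym .pos ;; .add .pos .pos .one ;; .const .run 0 ;; .load .top .stackTag .depth ;;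
    switch branches

theorem Ready.eval_branch {inp : List ℕ} {M X : ℕ} {ns : List Infon} {adj : ℕ → List (ℕ × ℕ)}
    {q : List ℕ} {σ : Parser} {s : St} (h : Ready M X ns adj q σ s) (a : Symbol) :
    ∃ c, branches[a.code]? = some c ∧
      Outcome M X ns.length (s.reg .pos) (σ.next a) (c.eval inp s) := by
  cases a
  · exact ⟨_, rfl, h.eval_readStart (f := .done .top) rfl h.heap.top⟩
  · exact ⟨_, rfl, h.eval_readStart (f := .done .bot) rfl h.heap.bot⟩
  · exact ⟨_, rfl, h.eval_readStart (f := .word []) rfl h.heap.var⟩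
  · exact ⟨_, rfl, h.eval_readBit false⟩
  · exact ⟨_, rfl, h.eval_readBit true⟩
  · exact ⟨_, rfl, h.eval_readLpar⟩
  · exact ⟨_, rfl, h.eval_readRpar⟩
  · exact ⟨_, rfl, h.eval_readConn .and⟩
  · exact ⟨_, rfl, h.eval_readConn .imp⟩
  · exact ⟨_, rfl, h.eval_readComma⟩
  · exact ⟨_, rfl, h.eval_readTurnstile⟩

/-- The reading loop has read `i` symbols of `w` without a syntax error. -/
def Reading (M X : ℕ) (w : List Symbol) (i : ℕ) (s : St) : Prop :=
  ∃ σ ns adj q, Parser.init.feed (w.take i) = some σ ∧ Core M X ns adj q s ∧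
    ParserRep ns q σ s ∧ s.reg .pos = i ∧ i ≤ w.length ∧ ns.length ≤ i + 3 ∧ σ.stack.length ≤ i ∧
    s.reg .ok = 0 ∧ s.reg .run = 1

/-- The reading loop is finished; `ok` tells whether `w` is a sequent, and if so, then the queue
holds its hypotheses and `cur` is the number of its conclusion. -/
def ReadingDone (M X : ℕ) (w : List Symbol) (s : St) : Prop :=
  s.reg .run = 0 ∧ ∃ ns adj q, Core M X ns adj q s ∧ ns.length ≤ M ∧
    (s.reg .ok = 0 ∧ (∀ Γ φ, w ≠ encodeSequent Γ φ) ∨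
      s.reg .ok = 1 ∧ ∃ Γ φ, w = encodeSequent Γ φ ∧ ns[s.reg .cur]? = some φ ∧
        Hypotheses ns q Γ)

theorem Symbol.code_pos (a : Symbol) : 0 < a.code := by cases a <;> decide

theorem Symbol.code_le (a : Symbol) : a.code ≤ 11 := by cases a <;> decide

theorem Parser.length_stack_next {σ σ' : Parser} {a : Symbol} (h : σ.next a = some σ') :
    σ'.stack.length ≤ σ.stack.length + 1 := by
  obtain ⟨hyps, seen, stack, focus⟩ := σ
  cases a <;>
    simp only [Parser.next, Parser.start, Parser.bit, Parser.connective] at h <;>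
    split at h <;> simp only [Option.some.injEq, reduceCtorEq] at h <;> subst h <;>
    (simp_all; try omega)

/-- Each iteration of the reading loop follows the parser by one symbol, or is the last one. -/
theorem Reading.step {M X : ℕ} {w : List Symbol} {i : ℕ} {s : St} (h : Reading M X w i s)
    (hM : M = w.length + 4) (hX : 4 * M * M ≤ X) :
    (i < w.length ∧ Reading M X w (i + 1) (readBody.eval (w.map Symbol.code) s)) ∨
      ReadingDone M X w (readBody.eval (w.map Symbol.code) s) := by
  obtain ⟨σ, ns, adj, q, hfeed, hcore, hparser, hpos, hi, hlen, hst, hok, hrun⟩ := h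
  have hMX : 4 * M ≤ X := by nlinarith
  have hone := hcore.heap.one
  -- the symbol read
  obtain ⟨k, hk⟩ : ∃ k, k = (w.map Symbol.code).getD i 0 := ⟨_, rfl⟩
  obtain ⟨s₀, hs₀⟩ : ∃ s₀, s₀ = (((s.set .sym k).set .pos (i + 1)).set .run 0).set .top
      (topTag σ.stack) := ⟨_, rfl⟩
  have hev : readBody.eval (w.map Symbol.code) s =
      (switch branches).eval (w.map Symbol.code) s₀ := by
    have htop : s.fld .stackTag (s.reg .depth) = topTag σ.stack :=
      hparser.depth ▸ hparser.stack.topTag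
    simp [readBody, Code.eval, hone, hpos, htop, hs₀, hk]
  have hone₀ : s₀.reg .one = 1 := by simpa [hs₀] using hone
  have hkX : k ≤ 11 := by
    rw [hk, List.getD_eq_getElem?_getD, List.getElem?_map]
    cases w[i]? with
    | none => simp
    | some a => exact a.code_le
  have htag : topTag σ.stack ≤ 3 := by
    rcases σ.stack with _ | ⟨_ | ⟨_ | _, _⟩, _⟩ <;> simp [topTag, Conn.tag]
  have hready : Ready M X ns adj q σ (s₀.set .sym 0) := by
    constructor
    case toCore =>
      rw [hs₀]
      exact ((((hcore.set (by decide) (by omega)).set (by decide) (by omega)).set (by decide)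
        (by omega)).set (by decide) (by omega)).set (by decide) (by omega)
    case parser =>
      obtain ⟨h1, h2, h3, h4, h5, h6⟩ := hparser
      exact ⟨by simpa [hs₀] using h1, h2.congr List.prefix_rfl (by simp [hs₀]),
        by simpa [hs₀] using h3, by simpa [hs₀] using h4, by simpa [hs₀] using h5, h6⟩
    case run => simp [hs₀]
    case ok => simpa [hs₀] using hok
    case top => simp [hs₀]
    case depth_lt => omega
    case length_lt => omega
    case le => exact hX
  have hp : (s₀.set .sym 0).reg .pos = i + 1 := by simp [hs₀]
  have hk₀ : s₀.reg .sym = k := by simp [hs₀]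
  rw [hev]
  rcases Nat.lt_or_ge i w.length with hlt | hge
  · have hka : k = w[i].code := by
      simp [hk, List.getD_eq_getElem?_getD, hlt]
    obtain ⟨c, hc, hout⟩ := hready.eval_branch (inp := w.map Symbol.code) w[i]
    rw [eval_switch hone₀ (by rw [hk₀, hka, hc])]
    obtain ⟨o1, o2, ns', adj', q', o3, o4, o5⟩ := hout
    have htake : Parser.init.feed (w.take (i + 1)) = σ.next w[i] := by
      rw [List.take_succ_eq_append_getElem hlt, Parser.feed_append, hfeed]
      simp [Parser.feed_cons]
    cases hnext : σ.next w[i] with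
    | some σ' =>
      rw [hnext] at o5 htake
      have := Parser.length_stack_next hnext
      exact .inl ⟨hlt, σ', ns', adj', q', htake, o3, o5.2, o1.trans hp, hlt, by omega, by omega,
        o2, o5.1⟩
    | none =>
      rw [hnext] at o5 htake
      refine .inr ⟨o5, ns', adj', q', o3, by omega, .inl ⟨o2, fun Γ φ hw => ?_⟩⟩
      obtain ⟨τ, hτ, -⟩ := Parser.feed_eq_iff.2 hw
      rw [← List.take_append_drop (i + 1) w, Parser.feed_append, htake] at hτ
      cases hτ
  -- past the end, the input symbol is `0`, which is not the code of a symbol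
  · have hk0 : k = 0 := by
      simp [hk, List.getD_eq_getElem?_getD, hge]
    rw [eval_switch hone₀ (c := readEnd) (by rw [hk₀, hk0]; rfl)]
    obtain ⟨v, hv, hev', hres⟩ := hready.eval_readEnd (inp := w.map Symbol.code)
    rw [hev']
    rw [List.take_of_length_le hge] at hfeed
    refine .inr ⟨by simpa using hready.run, ns, adj, q,
      hready.toCore.set (by decide) (by omega), by omega, ?_⟩
    rcases hres with ⟨rfl, hres⟩ | ⟨rfl, φ, hres, hcur⟩
    · refine .inl ⟨by simp, fun Γ φ hw => ?_⟩
      obtain ⟨τ, hτ, hτ'⟩ := Parser.feed_eq_iff.2 hw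
      obtain rfl := Option.some_inj.1 (hfeed.symm.trans hτ)
      rw [hres] at hτ'
      cases hτ'
    · exact .inr ⟨by simp, σ.hyps, φ, Parser.feed_eq_iff.1 ⟨σ, hfeed, hres⟩, by simpa using hcur,
        hready.parser.hyps⟩

/-! ### Forward chaining -/

/-- Leave the loop if the queue is exhausted, and turn to the clauses of its next entry
otherwise. -/
def popBody : Code :=
  .sub .tmp .tail .head ;;
    .ifZero .tmp (.const .run 0)
      (.load .item .queue .head ;; .load .edge .first .item ;; .add .head .head .one)

/-- Apply the clause in the cell `edge` if its second premise is marked, too. -/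
def edgeBody : Code :=
  .load .item .target .edge ;; .load .tmp .other .edge ;; .load .tmp .mark .tmp ;;
    .load .edge .next .edge ;; .ifZero .tmp .skip (push .item)

/-- The body of the forward chaining loop. -/
def chainBody : Code := .ifZero .edge popBody edgeBody

/-- The invariant of forward chaining from `Γ`. The first `h` entries of the queue have been
taken out, `x₀` is the last of them, and the clauses in `rem` are those with premise `x₀` that are
still to be considered. A clause whose premises have both been taken out has been applied when the
later one of them was considered, as it is recorded with both premises. The variables `cur` and `ok`
keep the values `c` and `b`. -/
structure Chaining (M X : ℕ) (ns : List Infon) (adj : ℕ → List (ℕ × ℕ)) (Γ : Set Infon)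
    (q₀ : List ℕ) (c b : ℕ) (q : List ℕ) (rem : List (ℕ × ℕ)) (h x₀ : ℕ) (s : St) : Prop
    extends Core M X ns adj q s where
  cur : s.reg .cur = c
  ok : s.reg .ok = b
  head : s.reg .head = h
  edge : Chain s (s.reg .ecnt) rem (s.reg .edge)
  head_le : h ≤ q.length
  rem_sub : ∀ e ∈ rem, e ∈ adj x₀
  rem_mem : rem ≠ [] → x₀ ∈ q
  sub : q₀ ⊆ q
  closed : ∀ x y z, Clause adj x y z → x ∈ q.take h → y ∈ q.take h →
    z ∈ q ∨ (x = x₀ ∧ (y, z) ∈ rem) ∨ (y = x₀ ∧ (x, z) ∈ rem)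
  sound : ∀ x ∈ q, ∃ φ, ns[x]? = some φ ∧ Derives .PBotW Γ φ

/-- The number of iterations of the forward chaining loop that are left, up to the last one. -/
def potential (adj : ℕ → List (ℕ × ℕ)) (N : ℕ) (q : List ℕ) (rem : List (ℕ × ℕ)) (h : ℕ) : ℕ :=
  ∑ x ∈ Finset.range N \ (q.take h).toFinset, ((adj x).length + 1) + rem.length

section chaining

variable {inp : List ℕ} {M X : ℕ} {ns : List Infon} {adj : ℕ → List (ℕ × ℕ)} {Γ : Set Infon}
  {q₀ : List ℕ} {c b : ℕ} {q : List ℕ} {rem : List (ℕ × ℕ)} {h x₀ : ℕ} {s : St}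

/-- Taking out an entry of the queue: each clause with this premise becomes one to be considered. -/
theorem Chaining.pop (H : Chaining M X ns adj Γ q₀ c b q [] h x₀ s) (hlt : h < q.length)
    (hX : ns.length ≤ X) :
    ∃ s' rem' x₁, popBody.eval inp s = s' ∧
      Chaining M X ns adj Γ q₀ c b q rem' (h + 1) x₁ s' ∧ s'.reg .run = s.reg .run ∧
      potential adj ns.length q rem' (h + 1) < potential adj ns.length q [] h := by
  have hx : q[h]? = some q[h] := List.getElem?_eq_getElem hlt
  have hent := H.queue.entry _ _ hx
  have hmem : q[h] ∈ q := List.getElem_mem hlt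
  have htake : q.take (h + 1) = q.take h ++ [q[h]] := List.take_succ_eq_append_getElem hlt
  have hev : popBody.eval inp s = (((s.set .tmp (q.length - h)).set .item q[h]).set .edge
      (s.fld .first q[h])).set .head (h + 1) := by
    have : ¬ (q.length - h = 0) := by omega
    simp [popBody, Code.eval, H.queue.tail, H.head, this, hent, H.heap.one]
  have hlen := H.queue.length_le
  refine ⟨_, adj q[h], q[h], hev, ?_, by simp, ?_⟩
  · have hN := H.queue.lt _ hmem
    refine ⟨(((H.toCore.set (by decide) (by omega)).set (by decide) (by omega)).set (by decide)
      (H.bdd.2 _ _)).set (by decide) (by omega), ?_, ?_, ?_, ?_, hlt, fun e he => he,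
      fun _ => hmem, H.sub, fun x y z hcl hxm hym => ?_, H.sound⟩
    · simpa using H.cur
    · simpa using H.ok
    · simp
    · simpa using (H.heap.edges.chain q[h]).congr le_rfl (by simp)
    · rw [htake, List.mem_append, List.mem_singleton] at hxm hym
      rcases hxm with hxm | rfl
      · rcases hym with hym | rfl
        · rcases H.closed x y z hcl hxm hym with hz | ⟨-, hz⟩ | ⟨-, hz⟩
          · exact .inl hz
          · simp at hz
          · simp at hz
        · exact .inr (.inr ⟨rfl, hcl.2⟩)
      · exact .inr (.inl ⟨rfl, hcl.1⟩)
  · have hnot : q[h] ∉ q.take h := by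
      have hnd := htake ▸ H.queue.nodup.sublist (List.take_sublist (h + 1) q)
      rw [List.nodup_append] at hnd
      exact fun hm => hnd.2.2 _ hm _ (List.mem_singleton_self _) rfl
    have hmem' : q[h] ∈ Finset.range ns.length \ (q.take h).toFinset := by
      simp [H.queue.lt _ hmem, hnot]
    have herase : Finset.range ns.length \ (q.take (h + 1)).toFinset =
        (Finset.range ns.length \ (q.take h).toFinset).erase q[h] := by
      rw [htake]
      ext x
      simp only [Finset.mem_sdiff, Finset.mem_erase, Finset.mem_range, List.mem_toFinset,
        List.mem_append, List.mem_singleton]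
      tauto
    have hsum := Finset.add_sum_erase _ (fun x => (adj x).length + 1) hmem'
    simp only [potential, herase, List.length_nil]
    omega

/-- Considering a clause: if the second premise is not in the queue, then the clause may be dropped,
since it will be considered again when this premise is taken out. -/
theorem Chaining.edgeStep {e : ℕ × ℕ} (H : Chaining M X ns adj Γ q₀ c b q (e :: rem) h x₀ s)
    (hX : ns.length ≤ X) :
    ∃ s' q', edgeBody.eval inp s = s' ∧ Chaining M X ns adj Γ q₀ c b q' rem h x₀ s' ∧
      s'.reg .run = s.reg .run ∧
      potential adj ns.length q' rem h < potential adj ns.length q (e :: rem) h := by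
  obtain ⟨y, z⟩ := e
  obtain ⟨-, -, hother, htarget, hchain⟩ := H.edge
  obtain ⟨s₁, hs₁⟩ : ∃ s₁, s₁ = ((s.set .item z).set .tmp (s.fld .mark y)).set .edge
      (s.fld .next (s.reg .edge)) := ⟨_, rfl⟩
  have hev : edgeBody.eval inp s = (Code.ifZero .tmp .skip (push .item)).eval inp s₁ := by
    simp [edgeBody, Code.eval, hother, htarget, hs₁]
  have hx₀ : x₀ ∈ q := H.rem_mem (by simp)
  have hyz := H.heap.edges.sound x₀ (y, z) (H.rem_sub _ (by simp))
  have hent := hyz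
  obtain ⟨φ, ψ, χ, h₁, h₂, h₃, h₄⟩ := hent
  simp only at h₁ h₂ h₃
  have hz := lt_of_getElem?_eq_some h₃
  have hcore : Core M X ns adj q s₁ := by
    rw [hs₁]
    exact ((H.toCore.set (by decide) (by omega)).set (by decide) (H.bdd.2 _ _)).set (by decide)
      (H.bdd.2 _ _)
  have hchain₁ : Chain s₁ (s₁.reg .ecnt) rem (s₁.reg .edge) := by
    rw [hs₁]
    simpa using hchain.congr le_rfl (by simp)
  have hpot : ∀ q', q <+: q' → potential adj ns.length q' rem h <
      potential adj ns.length q ((y, z) :: rem) h := by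
    rintro q' ⟨t, rfl⟩
    simp [potential, List.take_append_of_le_length H.head_le]
  rw [hev, Code.eval]
  by_cases h0 : s.fld .mark y = 0
  · have hy : y ∉ q := fun hy => (H.queue.mark y).2 hy h0
    rw [if_pos (by simpa [hs₁] using h0), Code.eval]
    refine ⟨s₁, q, rfl, ⟨hcore, ?_, ?_, ?_, hchain₁, H.head_le,
      fun e he => H.rem_sub e (by simp [he]), fun _ => hx₀, H.sub,
      fun x y' z' hcl hxm hym => ?_, H.sound⟩, by simp [hs₁], hpot q List.prefix_rfl⟩
    · simpa [hs₁] using H.cur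
    · simpa [hs₁] using H.ok
    · simpa [hs₁] using H.head
    · rcases H.closed x y' z' hcl hxm hym with hz | ⟨hx, hz⟩ | ⟨hx, hz⟩
      · exact .inl hz
      · rcases List.mem_cons.1 hz with hz | hz
        · obtain ⟨rfl, rfl⟩ := Prod.mk.inj hz
          exact absurd (List.mem_of_mem_take hym) hy
        · exact .inr (.inl ⟨hx, hz⟩)
      · rcases List.mem_cons.1 hz with hz | hz
        · obtain ⟨rfl, rfl⟩ := Prod.mk.inj hz
          exact absurd (List.mem_of_mem_take hxm) hy
        · exact .inr (.inr ⟨hx, hz⟩)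
  · have hy : y ∈ q := (H.queue.mark y).1 h0
    rw [if_neg (by simpa [hs₁] using h0)]
    have hitem : s₁.reg .item = z := by simp [hs₁]
    obtain ⟨q', hpre, hmem, hq', hag, hb⟩ := hcore.queue.eval_push (inp := inp) hcore.heap.one
      (a := .item) (by decide) (by rwa [hitem]) hcore.bdd hX
    rw [hitem] at hmem
    have hreg := hag.reg
    have hfld := hag.fld
    refine ⟨_, q', rfl, ?_, ?_, hpot q' hpre⟩
    · generalize (push .item).eval inp s₁ = s₂ at *
      have hheap : Heap M ns adj s₂ := by
        refine hcore.heap.congr (fun v hv => hreg v ?_) (fun f hf => hfld f ?_)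
        · revert v; decide
        · revert f; decide
      refine ⟨⟨hheap, hq', hb⟩, ?_, ?_, ?_, ?_, H.head_le.trans hpre.length_le,
        fun e he => H.rem_sub e (by simp [he]), fun _ => (hmem _).2 (.inl hx₀),
        fun x hx => (hmem x).2 (.inl (H.sub hx)), fun x y' z' hcl hxm hym => ?_, fun x hx => ?_⟩
      · simpa [hreg, hs₁] using H.cur
      · simpa [hreg, hs₁] using H.ok
      · simpa [hreg, hs₁] using H.head
      · rw [hreg .ecnt (by decide), hreg .edge (by decide)]
        exact hchain₁.congr le_rfl (by simp [hfld])
      · have htake : q'.take h = q.take h := by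
          obtain ⟨t, rfl⟩ := hpre
          exact List.take_append_of_le_length H.head_le
        rw [htake] at hxm hym
        rcases H.closed x y' z' hcl hxm hym with hz | ⟨hx, hz⟩ | ⟨hx, hz⟩
        · exact .inl ((hmem _).2 (.inl hz))
        · rcases List.mem_cons.1 hz with hz | hz
          · exact .inl ((hmem _).2 (.inr (Prod.mk.inj hz).2))
          · exact .inr (.inl ⟨hx, hz⟩)
        · rcases List.mem_cons.1 hz with hz | hz
          · exact .inl ((hmem _).2 (.inr (Prod.mk.inj hz).2))
          · exact .inr (.inr ⟨hx, hz⟩)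
      · rcases (hmem x).1 hx with hx | rfl
        · exact H.sound x hx
        · obtain ⟨φ', e₁, d₁⟩ := H.sound _ hx₀
          obtain ⟨ψ', e₂, d₂⟩ := H.sound _ hy
          obtain rfl := Option.some_inj.1 (h₁.symm.trans e₁)
          obtain rfl := Option.some_inj.1 (h₂.symm.trans e₂)
          exact ⟨χ, h₃, h₄ Γ d₁ d₂⟩
    · rw [hreg .run (by decide)]
      simp [hs₁]

/-- The loop invariant of forward chaining, with a bound `m` of the number of iterations. -/
def ChainInv (M X : ℕ) (ns : List Infon) (adj : ℕ → List (ℕ × ℕ)) (Γ : Set Infon)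
    (q₀ : List ℕ) (c b : ℕ) (m : ℕ) (s : St) : Prop :=
  ∃ q rem h x₀, Chaining M X ns adj Γ q₀ c b q rem h x₀ s ∧
    (s.reg .run = 1 ∧ potential adj ns.length q rem h < m ∨
      s.reg .run = 0 ∧ rem = [] ∧ h = q.length)

theorem ChainInv.step {m : ℕ} (H : ChainInv M X ns adj Γ q₀ c b m s) (hX : ns.length ≤ X)
    (hrun : s.reg .run ≠ 0) :
    ∃ m' < m, ChainInv M X ns adj Γ q₀ c b m' (chainBody.eval inp s) := by
  obtain ⟨q, rem, h, x₀, H, ⟨hr, hm⟩ | ⟨hr, -⟩⟩ := H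
  swap
  · exact absurd hr hrun
  rcases rem with _ | ⟨e, rem⟩
  · have hedge : s.reg .edge = 0 := H.edge
    have hev : chainBody.eval inp s = popBody.eval inp s := by
      rw [chainBody, Code.eval, if_pos hedge]
    rw [hev]
    rcases H.head_le.lt_or_eq with hlt | heq
    · obtain ⟨s', rem', x₁, rfl, H', hr', hp⟩ := H.pop (inp := inp) hlt hX
      exact ⟨m - 1, by omega, q, rem', h + 1, x₁, H', .inl ⟨hr'.trans hr, by omega⟩⟩
    · have hev' : popBody.eval inp s = (s.set .tmp 0).set .run 0 := by
        simp [popBody, Code.eval, H.queue.tail, H.head, heq]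
      rw [hev']
      refine ⟨0, by omega, q, [], h, x₀, ⟨(H.toCore.set (by decide) (by omega)).set (by decide)
        (by omega), by simpa using H.cur, by simpa using H.ok, by simpa using H.head, hedge,
        H.head_le, H.rem_sub, H.rem_mem, H.sub, H.closed, H.sound⟩, .inr ⟨by simp, rfl, heq⟩⟩
  · have hedge : s.reg .edge ≠ 0 := H.edge.1
    have hev : chainBody.eval inp s = edgeBody.eval inp s := by
      rw [chainBody, Code.eval, if_neg hedge]
    rw [hev]
    obtain ⟨s', q', rfl, H', hr', hp⟩ := H.edgeStep (inp := inp) hX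
    exact ⟨m - 1, by omega, q', rem, h, x₀, H', .inl ⟨hr'.trans hr, by omega⟩⟩

end chaining

theorem Heap.conj_node {M : ℕ} {ns : List Infon} {adj : ℕ → List (ℕ × ℕ)} {s : St}
    (h : Heap M ns adj s) {n : ℕ} {φ ψ : Infon} (hn : ns[n]? = some (.conj φ ψ)) :
    ∃ l r, ns[l]? = some φ ∧ ns[r]? = some ψ ∧
      Clause adj n n l ∧ Clause adj n n r ∧ Clause adj l r n := by
  have h3 : 3 ≤ n := by
    by_contra hlt
    have ht := h.top
    have hb := h.bot
    have hv := h.var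
    obtain rfl | rfl | rfl : n = 0 ∨ n = 1 ∨ n = 2 := by omega
    all_goals simp_all
  obtain ⟨t, l, r, hN, -, hc⟩ := h.node n _ h3 hn
  cases hN with
  | conj hl hr => exact ⟨l, r, hl, hr, hc.1 rfl⟩

theorem Heap.imp_node {M : ℕ} {ns : List Infon} {adj : ℕ → List (ℕ × ℕ)} {s : St}
    (h : Heap M ns adj s) {n : ℕ} {φ ψ : Infon} (hn : ns[n]? = some (.imp φ ψ)) :
    ∃ l r, ns[l]? = some φ ∧ ns[r]? = some ψ ∧
      Clause adj r r n ∧ Clause adj l n r ∧ Clause adj 1 n r := by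
  have h3 : 3 ≤ n := by
    by_contra hlt
    have ht := h.top
    have hb := h.bot
    have hv := h.var
    obtain rfl | rfl | rfl : n = 0 ∨ n = 1 ∨ n = 2 := by omega
    all_goals simp_all
  obtain ⟨t, l, r, hN, -, hc⟩ := h.node n _ h3 hn
  cases hN with
  | imp hl hr => exact ⟨l, r, hl, hr, hc.2 rfl⟩

/-- A set of numbers that is closed under all clauses is a locally closed set of infons. -/
theorem Heap.locallyClosed {M : ℕ} {ns : List Infon} {adj : ℕ → List (ℕ × ℕ)} {s : St}
    (h : Heap M ns adj s) {q : List ℕ} (h0 : 0 ∈ q)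
    (hq : ∀ x y z, Clause adj x y z → x ∈ q → y ∈ q → z ∈ q) :
    LocallyClosed {φ | φ ∈ ns} {φ | ∃ x ∈ q, ns[x]? = some φ} := by
  have hnd := h.nodup
  refine ⟨?_, ?_, ?_, ⟨0, h0, h.top⟩, ?_, ?_, ?_, ?_, ?_⟩
  · rintro φ ⟨x, -, hx⟩
    exact List.mem_of_getElem? hx
  · intro φ ψ hmem
    obtain ⟨n, hn⟩ := List.mem_iff_getElem?.1 hmem
    obtain ⟨l, r, hl, hr, -⟩ := h.conj_node hn
    exact ⟨List.mem_of_getElem? hl, List.mem_of_getElem? hr⟩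
  · intro φ ψ hmem
    obtain ⟨n, hn⟩ := List.mem_iff_getElem?.1 hmem
    obtain ⟨l, r, hl, hr, -⟩ := h.imp_node hn
    exact ⟨List.mem_of_getElem? hl, List.mem_of_getElem? hr⟩
  · rintro φ ψ hmem ⟨x, hx, hxφ⟩ ⟨y, hy, hyψ⟩
    obtain ⟨n, hn⟩ := List.mem_iff_getElem?.1 hmem
    obtain ⟨l, r, hl, hr, -, -, hc⟩ := h.conj_node hn
    obtain rfl := index_unique hnd hl hxφ
    obtain rfl := index_unique hnd hr hyψ
    exact ⟨n, hq _ _ _ hc hx hy, hn⟩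
  · rintro φ ψ ⟨n, hnq, hn⟩
    obtain ⟨l, r, hl, hr, hc₁, hc₂, -⟩ := h.conj_node hn
    exact ⟨⟨l, hq _ _ _ hc₁ hnq hnq, hl⟩, ⟨r, hq _ _ _ hc₂ hnq hnq, hr⟩⟩
  · rintro φ ψ hmem ⟨y, hy, hyψ⟩
    obtain ⟨n, hn⟩ := List.mem_iff_getElem?.1 hmem
    obtain ⟨l, r, hl, hr, hc, -⟩ := h.imp_node hn
    obtain rfl := index_unique hnd hr hyψ
    exact ⟨n, hq _ _ _ hc hy hy, hn⟩
  · rintro φ ψ ⟨n, hnq, hn⟩ ⟨x, hx, hxφ⟩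
    obtain ⟨l, r, hl, hr, -, hc, -⟩ := h.imp_node hn
    obtain rfl := index_unique hnd hl hxφ
    exact ⟨r, hq _ _ _ hc hx hnq, hr⟩
  · rintro φ ψ ⟨n, hnq, hn⟩ ⟨x, hx, hxφ⟩
    obtain ⟨l, r, hl, hr, -, -, hc⟩ := h.imp_node hn
    obtain rfl := index_unique hnd h.bot hxφ
    exact ⟨r, hq _ _ _ hc hx hnq, hr⟩

/-! ### The machine -/

/-- A piece of a program, as a function of its position. -/
abbrev Piece : Type := ℕ → List Instr

/-- One piece after another. -/
def Piece.append (f g : Piece) : Piece := fun o => f o ++ g (o + (f o).length)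

/-- From every state with property `P`, the piece leads in at most `T` steps to a state with
property `Q`, and the numbers stay below `Y`. -/
def Piece.Runs (inp : List ℕ) (Y : ℕ) (f : Piece) (P Q : St → Prop) (T : ℕ) : Prop :=
  ∀ (p : Program) (c : Config) (s : St), CodeAt p c.pc (f c.pc) → Refines s c → c.BoundedBy Y →
    P s → ∃ n ≤ T, ∃ c' s', Reach p inp Y c n c' ∧ c'.pc = c.pc + (f c.pc).length ∧
      Refines s' c' ∧ Q s'

theorem Piece.Runs.append {inp : List ℕ} {Y : ℕ} {f g : Piece} {P Q R : St → Prop} {T U : ℕ}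
    (hf : f.Runs inp Y P Q T) (hg : g.Runs inp Y Q R U) :
    (f.append g).Runs inp Y P R (T + U) := by
  intro p c s hp hr hc hP
  obtain ⟨hp₁, hp₂⟩ := codeAt_append.1 hp
  obtain ⟨n, hn, d, t, r₁, hpc₁, hr₁, hQ⟩ := hf p c s hp₁ hr hc hP
  rw [← hpc₁] at hp₂
  obtain ⟨n', hn', d', t', r₂, hpc₂, hr₂, hR⟩ := hg p d t hp₂ hr₁ r₁.bounded hQ
  refine ⟨n + n', by omega, d', t', r₁.trans r₂, ?_, hr₂, hR⟩
  rw [hpc₂, Piece.append, List.length_append, ← hpc₁, hpc₁]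
  omega

theorem Code.runs {inp : List ℕ} (hinp : ∀ a ∈ inp, a ≤ 11) {X Y : ℕ} (code : Code)
    {P Q : St → Prop} (hX : 11 ≤ X) (hY : 32 * (code.growth * X) ≤ Y) (hP : ∀ s, P s → s.Bdd X)
    (hQ : ∀ s, P s → Q (code.eval inp s)) : Piece.Runs inp Y code.compile P Q code.len := by
  intro p c s hp hr hc hs
  obtain ⟨n, hn, c', r, hpc, hr', -⟩ := code.reach_compile hinp hp hr hc (hP s hs) hX hY
  exact ⟨n, hn, c', _, r, by rw [hpc, Code.length_compile], hr', hQ s hs⟩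

theorem loop_runs {inp : List ℕ} (hinp : ∀ a ∈ inp, a ≤ 11) {X Y : ℕ} (a : Var) (body : Code)
    (I : ℕ → St → Prop) {P : St → Prop} (m : ℕ) (hX : 11 ≤ X)
    (hY : 32 * (body.growth * X) ≤ Y) (hbd : ∀ m s, I m s → s.Bdd X)
    (hstep : ∀ m s, I m s → s.reg a ≠ 0 → ∃ m' < m, I m' (body.eval inp s))
    (hP : ∀ s, P s → I m s) :
    Piece.Runs inp Y (loopCode a body) P (fun s => (∃ m, I m s) ∧ s.reg a = 0)
      ((body.len + 2) * (m + 1)) := by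
  intro p c s hp hr hc hs
  obtain ⟨n, hn, c', s', m', r, hpc, hr', hI, h0⟩ :=
    reach_loopCode hinp a body I hbd hX hstep hY m (hP s hs) hp hr hc
  exact ⟨n, hn, c', s', r, by rw [hpc, length_loopCode], hr', ⟨m', hI⟩, h0⟩

/-- Preparation of the loop that counts the input symbols. -/
def countSetup : Code := .const .one 1 ;; .const .size 4 ;; .input .sym .pos

/-- The body of the loop that sets `size` to the length of the input plus `4`. -/
def countBody : Code := .add .pos .pos .one ;; .add .size .size .one ;; .input .sym .pos

/-- Preparation of the reading loop: the infons `⊤`, `⊥` and the atom with the empty name get the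
numbers `0`, `1` and `2`, and `⊤` is put into the queue. -/
def readSetup : Code :=
  .const .pos 0 ;; .const .cnt 3 ;; .const .ecnt 1 ;; .store .row .one .size ;;
    .add .row .size .size ;; .const .tmp 2 ;; .store .row .tmp .row ;; .add .row .row .size ;;
    .const .tmp 0 ;; .store .mark .tmp .one ;; .const .tail 1 ;; .const .run 1

/-- Preparation of the forward chaining loop. -/
def chainSetup : Code := .const .run 1 ;; .const .edge 0 ;; .const .head 0

/-- Accept if the input is a sequent and its conclusion is marked. -/
def finish : Code :=
  .ifZero .ok (.const .out 0)
    (.load .tmp .mark .cur ;; .ifZero .tmp (.const .out 0) (.const .out 1))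

/-- The machine that decides derivability in `P[⊥_w]`. -/
def decider : Piece :=
  Piece.append countSetup.compile <| Piece.append (loopCode .sym countBody) <|
    Piece.append readSetup.compile <| Piece.append (loopCode .run readBody) <|
    Piece.append chainSetup.compile <| Piece.append (loopCode .run chainBody) finish.compile

/-- The state of the counting loop at position `p`. -/
def countState (inp : List ℕ) (p : ℕ) : St :=
  (((St.init.set .one 1).set .size (p + 4)).set .sym (inp.getD p 0)).set .pos p

theorem St.ext {s s' : St} (h₁ : ∀ v, s.reg v = s'.reg v) (h₂ : s.fld = s'.fld) : s = s' := by
  obtain ⟨r, f⟩ := s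
  obtain ⟨r', f'⟩ := s'
  simp only [St.mk.injEq]
  exact ⟨funext h₁, h₂⟩

theorem eval_countSetup (inp : List ℕ) :
    countSetup.eval inp St.init = countState inp 0 := by
  refine St.ext (fun v => ?_) rfl
  cases v <;> simp [countSetup, Code.eval, countState, St.init]

theorem eval_countBody (inp : List ℕ) (p : ℕ) :
    countBody.eval inp (countState inp p) = countState inp (p + 1) := by
  refine St.ext (fun v => ?_) rfl
  cases v <;> simp [countBody, Code.eval, countState, St.init]

theorem bdd_init (X : ℕ) : St.init.Bdd X := ⟨fun _ => Nat.zero_le _, fun _ _ => Nat.zero_le _⟩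

theorem bdd_countState {inp : List ℕ} (hinp : ∀ a ∈ inp, a ≤ 11) {p X : ℕ} (hp : p + 4 ≤ X)
    (hX : 11 ≤ X) : (countState inp p).Bdd X := by
  refine ((((bdd_init X).set _ (by omega)).set _ hp).set _ ?_).set _ (by omega)
  rw [List.getD_eq_getElem?_getD]
  cases h : inp[p]? with
  | none => simp
  | some x => exact (hinp x (List.mem_of_getElem? h)).trans hX

theorem reading_readSetup (w : List Symbol) {M X : ℕ} (hM : M = w.length + 4)
    (hX : 4 * M * M ≤ X) :
    Reading M X w 0 (readSetup.eval (w.map Symbol.code)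
      (countState (w.map Symbol.code) w.length)) := by
  have hMX : 4 * M ≤ X := by nlinarith
  have hbd := bdd_countState (inp := w.map Symbol.code) (p := w.length) (X := X)
    (by simpa using fun a _ => a.code_le) (by omega) (by omega)
  set s₀ := countState (w.map Symbol.code) w.length with hs₀
  have hsize : s₀.reg .size = M := by simp [hs₀, countState, hM]
  have hone : s₀.reg .one = 1 := by simp [hs₀, countState]
  have hfld : ∀ f i, s₀.fld f i = 0 := fun _ _ => rfl
  have hdepth : s₀.reg .depth = 0 := rfl
  have hfocus : s₀.reg .focus = 0 := rfl
  have hseen : s₀.reg .seen = 0 := rfl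
  have hok : s₀.reg .ok = 0 := rfl
  clear_value s₀
  refine ⟨Parser.init, [.top, .bot, .atom []], fun _ => [], [0], by simp, ⟨?_, ?_, ?_⟩, ?_, ?_,
    by omega, by simp, by simp [Parser.init], ?_, ?_⟩
  · constructor
    case edges =>
      exact ⟨fun x => by simp [Chain, readSetup, Code.eval, hfld], fun F => by
        simp [readSetup, Code.eval], by simp⟩
    case rows =>
      intro k hk
      simp only [List.length_cons, List.length_nil] at hk
      obtain rfl | rfl | rfl : k = 0 ∨ k = 1 ∨ k = 2 := by omega
      all_goals simp [readSetup, Code.eval, hfld, hone, hsize]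
      omega
    case table =>
      intro t l r _ _ hne
      simp [readSetup, Code.eval, hfld] at hne
    case node =>
      intro n φ hn hφ
      have := lt_of_getElem?_eq_some hφ
      simp at this
      omega
    all_goals simp [readSetup, Code.eval, hone, hsize]
    omega
  · constructor
    case entry =>
      intro k x hk
      have := lt_of_getElem?_eq_some hk
      obtain rfl : k = 0 := by simpa using this
      simpa [readSetup, Code.eval, hfld] using hk
    all_goals simp [readSetup, Code.eval, hfld, hone]
  · simp only [readSetup, Code.eval, St.reg_set, St.reg_put, hone, hsize]
    simp only [reduceCtorEq, if_true, if_false]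
    repeat' first
      | exact hbd
      | refine St.Bdd.set ?_ _ ?_
      | refine St.Bdd.put ?_ _ _ ?_
    all_goals omega
  · constructor
    case hyps => exact ⟨by simp, by simp [Parser.init], by simp⟩
    all_goals simp [readSetup, Code.eval, Parser.init, StackRep, Focus.code, Focus.infon?, hfld,
      hdepth, hseen, hfocus]
  all_goals simp [readSetup, Code.eval, hok]

theorem encodeSequent_injective {Γ Δ : List Infon} {φ ψ : Infon}
    (h : encodeSequent Γ φ = encodeSequent Δ ψ) : Γ = Δ ∧ φ = ψ := by
  obtain ⟨σ, h₁, h₂⟩ := Parser.feed_eq_iff.2 h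
  obtain ⟨τ, h₃, h₄⟩ := Parser.feed_eq_iff.2 (rfl : encodeSequent Γ φ = _)
  obtain rfl := Option.some_inj.1 (h₁.symm.trans h₃)
  exact Prod.mk.inj (Option.some_inj.1 (h₄.symm.trans h₂))

/-- What the reading loop hands over to forward chaining: the input `w` is not a sequent and
`b = 0`, or `b = 1`, the queue `q₀` holds the set `Γ` of its hypotheses, and `c` is the number of
its conclusion. -/
def Task (w : List Symbol) (ns : List Infon) (q₀ : List ℕ) (Γ : Set Infon) (c b : ℕ) : Prop :=
  b = 0 ∧ (∀ Γ φ, w ≠ encodeSequent Γ φ) ∨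
    b = 1 ∧ ∃ (Δ : List Infon) (φ : Infon), w = encodeSequent Δ φ ∧ Γ = {γ | γ ∈ Δ} ∧
      ns[c]? = some φ ∧ Hypotheses ns q₀ Δ

/-- The invariant of the forward chaining loop in the run on the input `w`. -/
def DecideInv (M X : ℕ) (w : List Symbol) (m : ℕ) (s : St) : Prop :=
  ∃ ns adj Γ q₀ c b, ns.length ≤ M ∧ Task w ns q₀ Γ c b ∧ ChainInv M X ns adj Γ q₀ c b m s

theorem ReadingDone.decideInv {M X : ℕ} {w : List Symbol} {s : St} {inp : List ℕ}
    (h : ReadingDone M X w s) (hX : 1 ≤ X) :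
    DecideInv M X w (7 * M + 1) (chainSetup.eval inp s) := by
  obtain ⟨hrun, ns, adj, q, hcore, hlen, hres⟩ := h
  have hev : chainSetup.eval inp s = ((s.set .run 1).set .edge 0).set .head 0 := rfl
  -- each of the at most `M` infons has at most three clauses, which are recorded twice
  have hpot : potential adj ns.length q [] 0 < 7 * M + 1 := by
    have h₁ := hcore.heap.edges.total (Finset.range ns.length)
    have h₂ := hcore.heap.ecnt_le
    simp [potential, Finset.sum_add_distrib]
    omega
  have key : ∀ Γ : Set Infon, (∀ x ∈ q, ∃ φ, ns[x]? = some φ ∧ Derives .PBotW Γ φ) →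
      ChainInv M X ns adj Γ q (s.reg .cur) (s.reg .ok) (7 * M + 1) (chainSetup.eval inp s) := by
    intro Γ hΓ
    rw [hev]
    exact ⟨q, [], 0, 0, ⟨((hcore.set (by decide) hX).set (by decide) (by omega)).set (by decide)
      (by omega), by simp, by simp, by simp, by simp [Chain], by omega, by simp, by simp,
      List.Subset.refl _, by simp, hΓ⟩, .inl ⟨by simp, hpot⟩⟩
  rcases hres with ⟨hok, hw⟩ | ⟨hok, Δ, φ, hw, hcur, hhyps⟩
  -- forward chaining is then of no use, but it terminates, and every infon is derivable from all
  · refine ⟨ns, adj, Set.univ, q, _, _, hlen, .inl ⟨hok, hw⟩, key _ fun x hx => ?_⟩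
    exact ⟨_, List.getElem?_eq_getElem (hcore.queue.lt x hx), Derives.of_mem trivial⟩
  · refine ⟨ns, adj, {γ | γ ∈ Δ}, q, _, _, hlen, .inr ⟨hok, Δ, φ, hw, rfl, hcur, hhyps⟩,
      key _ fun x hx => ?_⟩
    obtain ⟨ψ, hψ, rfl | hm⟩ := hhyps.sub x hx
    · exact ⟨_, hψ, Derives.top' _⟩
    · exact ⟨_, hψ, Derives.of_mem hm⟩

theorem DecideInv.eval_finish {M X m : ℕ} {w : List Symbol} {s : St} {inp : List ℕ}
    (h : DecideInv M X w m s) (hrun : s.reg .run = 0) :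
    (finish.eval inp s).reg .out = 1 ↔ w ∈ derivabilityProblem .PBotW := by
  obtain ⟨ns, adj, Γ, q₀, c, b, -, htask, q, rem, h, x₀, H, ⟨hr, -⟩ | ⟨-, rfl, rfl⟩⟩ := h
  · omega
  rcases htask with ⟨rfl, hw⟩ | ⟨rfl, Δ, φ, rfl, rfl, hcur, hhyps⟩
  · have : (finish.eval inp s).reg .out = 0 := by simp [finish, Code.eval, H.ok]
    rw [this]
    refine iff_of_false (by decide) ?_
    rintro ⟨Δ, φ, e, -⟩
    exact hw Δ φ e
  · have hout : (finish.eval inp s).reg .out = 1 ↔ c ∈ q := by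
      rw [← H.queue.mark c]
      by_cases h0 : s.fld .mark c = 0 <;> simp [finish, Code.eval, H.ok, H.cur, h0]
    have hclosed := H.closed
    simp only [List.take_length, List.not_mem_nil, and_false, or_false] at hclosed
    have hloc := H.heap.locallyClosed (H.sub hhyps.top) hclosed
    rw [hout]
    constructor
    · intro hc
      obtain ⟨ψ, hψ, hd⟩ := H.sound c hc
      obtain rfl := Option.some_inj.1 (hψ.symm.trans hcur)
      exact ⟨Δ, ψ, rfl, hd⟩
    · rintro ⟨Δ', φ', e, hd⟩
      obtain ⟨rfl, rfl⟩ := encodeSequent_injective e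
      obtain ⟨x, hx, hxφ⟩ := hloc.mem_of_derives hd (fun γ hγ => by
        obtain ⟨x, hx, hxγ⟩ := hhyps.mem γ hγ
        exact ⟨x, H.sub hx, hxγ⟩) (List.mem_of_getElem? hcur)
      rwa [index_unique H.heap.nodup hcur hxφ]

/-- A common factor by which the pieces of the machine increase a bound at most. -/
def deciderGrowth : ℕ :=
  countSetup.growth + countBody.growth + readSetup.growth + readBody.growth +
    chainSetup.growth + chainBody.growth + finish.growth

/-- The factor in the linear bound of the running time. -/
def deciderTime : ℕ :=
  countSetup.len + (countBody.len + 2) + readSetup.len + 2 * (readBody.len + 2) +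
    chainSetup.len + 30 * (chainBody.len + 2) + finish.len

/-- The run of the machine. Numbers at the heads of the loops are bounded by `4 * M * M`, the
size of the table. -/
theorem decider_runs (w : List Symbol) {M X : ℕ} (hM : M = w.length + 4) (hX : X = 4 * M * M) :
    decider.Runs (w.map Symbol.code) (32 * (deciderGrowth * X)) (fun s => s = St.init)
      (fun s => s.reg .out = 1 ↔ w ∈ derivabilityProblem .PBotW)
      (deciderTime * (w.length + 1)) := by
  have hinp : ∀ a ∈ w.map Symbol.code, a ≤ 11 := by simpa using fun a _ => a.code_le
  have hMX : 4 * M ≤ X := by nlinarith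
  have hX11 : 11 ≤ X := by omega
  have hG : ∀ g ≤ deciderGrowth, 32 * (g * X) ≤ 32 * (deciderGrowth * X) := fun g hg =>
    Nat.mul_le_mul_left _ (Nat.mul_le_mul_right _ hg)
  have p₁ := Code.runs hinp countSetup (P := fun s => s = St.init)
    (Q := fun s => s = countState (w.map Symbol.code) 0) hX11
    (hG _ (by unfold deciderGrowth; omega)) (fun s hs => hs ▸ bdd_init X)
    (fun s hs => hs ▸ eval_countSetup _)
  have p₂ := loop_runs hinp .sym countBody
    (fun m s => ∃ p, p + m = w.length ∧ s = countState (w.map Symbol.code) p)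
    (P := fun s => s = countState (w.map Symbol.code) 0) w.length hX11
    (hG _ (by unfold deciderGrowth; omega))
    (by rintro m s ⟨p, hp, rfl⟩; exact bdd_countState hinp (by omega) hX11)
    (by
      rintro m s ⟨p, hp, rfl⟩ hne
      have hlt : p < w.length := by
        by_contra hge
        simp [countState, List.getD_eq_getElem?_getD, not_lt.1 hge] at hne
      exact ⟨m - 1, by omega, p + 1, by omega, eval_countBody _ _⟩)
    (fun s hs => ⟨0, by omega, hs⟩)
  have hcount : ∀ s, ((∃ m p, p + m = w.length ∧ s = countState (w.map Symbol.code) p) ∧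
      s.reg .sym = 0) → s = countState (w.map Symbol.code) w.length := by
    rintro s ⟨⟨m, p, hp, rfl⟩, h0⟩
    have hge : ¬ p < w.length := by
      intro hlt
      have hpos := w[p].code_pos
      simp [countState, List.getD_eq_getElem?_getD, hlt] at h0
      omega
    rw [show p = w.length by omega]
  have p₃ := Code.runs hinp readSetup (Q := fun s => Reading M X w 0 s) hX11
    (hG _ (by unfold deciderGrowth; omega))
    (fun s hs => hcount s hs ▸ bdd_countState hinp (by omega) hX11)
    (fun s hs => hcount s hs ▸ reading_readSetup w hM hX.ge)
  have p₄ := loop_runs hinp .run readBody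
    (fun m s => (∃ i, i + m = w.length + 1 ∧ Reading M X w i s) ∨ ReadingDone M X w s)
    (P := fun s => Reading M X w 0 s) (w.length + 1) hX11
    (hG _ (by unfold deciderGrowth; omega))
    (by
      rintro m s (⟨i, -, σ, ns, adj, q, -, hcore, -⟩ | ⟨-, ns, adj, q, hcore, -⟩)
      exacts [hcore.bdd, hcore.bdd])
    (by
      rintro m s (⟨i, hi, h⟩ | h) hne
      · have hle : i ≤ w.length := by
          obtain ⟨σ, ns, adj, q, -, -, -, -, hle, -⟩ := h
          exact hle
        rcases h.step hM hX.ge with ⟨hlt, h'⟩ | h'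
        · exact ⟨m - 1, by omega, .inl ⟨i + 1, by omega, h'⟩⟩
        · exact ⟨m - 1, by omega, .inr h'⟩
      · exact absurd h.1 hne)
    (fun s hs => .inl ⟨0, by omega, hs⟩)
  have hread : ∀ s, ((∃ m, (∃ i, i + m = w.length + 1 ∧ Reading M X w i s) ∨
      ReadingDone M X w s) ∧ s.reg .run = 0) → ReadingDone M X w s := by
    rintro s ⟨⟨m, ⟨i, hi, h⟩ | h⟩, h0⟩
    · obtain ⟨σ, ns, adj, q, -, -, -, -, -, -, -, -, h1⟩ := h
      omega
    · exact h
  have p₅ := Code.runs hinp chainSetup (Q := fun s => DecideInv M X w (7 * M + 1) s) hX11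
    (hG _ (by unfold deciderGrowth; omega))
    (fun s hs => by
      obtain ⟨-, ns, adj, q, hcore, -⟩ := hread s hs
      exact hcore.bdd)
    (fun s hs => (hread s hs).decideInv (by omega))
  have hbd : ∀ m s, DecideInv M X w m s → s.Bdd X := by
    rintro m s ⟨ns, adj, Γ, q₀, c, b, -, -, q, rem, h, x₀, H, -⟩
    exact H.bdd
  have p₆ := loop_runs hinp .run chainBody (fun m s => DecideInv M X w m s)
    (P := fun s => DecideInv M X w (7 * M + 1) s) (7 * M + 1) hX11
    (hG _ (by unfold deciderGrowth; omega)) hbd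
    (by
      rintro m s ⟨ns, adj, Γ, q₀, c, b, hlen, htask, H⟩ hne
      obtain ⟨m', hm, H'⟩ := H.step (inp := w.map Symbol.code) (by omega) hne
      exact ⟨m', hm, ns, adj, Γ, q₀, c, b, hlen, htask, H'⟩)
    (fun s hs => hs)
  have p₇ := Code.runs hinp finish
    (P := fun s => (∃ m, DecideInv M X w m s) ∧ s.reg .run = 0)
    (Q := fun s => s.reg .out = 1 ↔ w ∈ derivabilityProblem .PBotW) hX11
    (hG _ (by unfold deciderGrowth; omega)) (fun s hs => hbd _ s hs.1.choose_spec)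
    (fun s hs => hs.1.choose_spec.eval_finish hs.2)
  have hall := p₁.append (p₂.append (p₃.append (p₄.append (p₅.append (p₆.append p₇)))))
  intro p c s h₁ h₂ h₃ h₄
  obtain ⟨n, hn, hrest⟩ := hall p c s h₁ h₂ h₃ h₄
  refine ⟨n, hn.trans ?_, hrest⟩
  have e : 7 * M + 1 + 1 ≤ 30 * (w.length + 1) := by omega
  have h₁ : (chainBody.len + 2) * (7 * M + 1 + 1) ≤ (chainBody.len + 2) * (30 * (w.length + 1)) :=
    Nat.mul_le_mul_left _ e
  have h₂ : (readBody.len + 2) * (w.length + 1 + 1) ≤ (readBody.len + 2) * (2 * (w.length + 1)) :=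
    Nat.mul_le_mul_left _ (by omega)
  have h₃ : ∀ a, a ≤ a * (w.length + 1) := fun a => Nat.le_mul_of_pos_right _ (by omega)
  have a₁ := h₃ countSetup.len
  have a₂ := h₃ readSetup.len
  have a₃ := h₃ chainSetup.len
  have a₄ := h₃ finish.len
  rw [deciderTime]
  linarith

theorem step_of_halted {p : Program} {inp : List ℕ} {c : Config} (h : Halted p c) :
    step p inp c = c := by
  simp [step, List.getElem?_eq_none h]

theorem decidableInLinearTime_PBotW : DecidableInLinearTime (derivabilityProblem .PBotW) := by
  refine ⟨decider 0, 32 * (deciderGrowth * 64) + deciderTime, 2, fun w => ?_⟩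
  obtain ⟨n, hn, c, s, hreach, hpc, hr, hs⟩ := decider_runs w rfl rfl (decider 0) Config.init
    St.init (codeAt_self _) ⟨fun _ => rfl, fun _ _ => rfl⟩
    ⟨fun _ => Nat.zero_le _, fun _ => Nat.zero_le _⟩ rfl
  have hhalt : Halted (decider 0) c := by
    rw [Halted, hpc]
    simp [Config.init]
  have hY : 32 * (deciderGrowth * (4 * (w.length + 4) * (w.length + 4))) ≤
      (32 * (deciderGrowth * 64) + deciderTime) * (w.length + 1) ^ 2 := by
    have : 4 * (w.length + 4) * (w.length + 4) ≤ 64 * (w.length + 1) ^ 2 := by nlinarith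
    calc 32 * (deciderGrowth * (4 * (w.length + 4) * (w.length + 4)))
        ≤ 32 * (deciderGrowth * (64 * (w.length + 1) ^ 2)) := by gcongr
      _ = 32 * (deciderGrowth * 64) * (w.length + 1) ^ 2 := by ring
      _ ≤ _ := by gcongr; omega
  refine ⟨fun t => ?_, n, hn.trans (by gcongr; omega), ?_, ?_⟩
  · have hb : (run (decider 0) (w.map Symbol.code) t).BoundedBy
        (32 * (deciderGrowth * (4 * (w.length + 4) * (w.length + 4)))) := by
      rcases le_total t n with h | h
      · exact hreach.2 t h
      · obtain ⟨k, rfl⟩ := Nat.exists_eq_add_of_le h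
        rw [run, Nat.add_comm, Function.iterate_add_apply, hreach.1,
          Function.iterate_fixed (step_of_halted hhalt)]
        exact hreach.bounded
    exact ⟨fun i => (hb.1 i).trans hY, fun i => (hb.2 i).trans hY⟩
  · rw [run, hreach.1]
    exact hhalt
  · rw [run, hreach.1, ← hs, ← hr.reg .out]
    rfl

end PrimalInfon

theorem mainTheorem6 :
    PrimalInfon.DecidableInLinearTime
      (PrimalInfon.derivabilityProblem PrimalInfon.InfonLogic.PBotW) ∧
    ∀ (Γ : Set PrimalInfon.Infon) (φ : PrimalInfon.Infon),
      PrimalInfon.Derives PrimalInfon.InfonLogic.PBotW Γ φ ↔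
        PrimalInfon.Derives PrimalInfon.InfonLogic.P Γ φ ∨
          (PrimalInfon.Derives PrimalInfon.InfonLogic.P Γ PrimalInfon.Infon.bot ∧
            PrimalInfon.posAtoms φ ⊆ PrimalInfon.posAtomsCtx Γ ∪ {PrimalInfon.Infon.top}) := by
  exact ⟨PrimalInfon.decidableInLinearTime_PBotW, PrimalInfon.derives_PBotW_iff⟩
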